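/- Let $\Sigma$ be a finite alphabet. Starting from the pool of all letters of $\Sigma$, an assembly step concatenates two words of the current pool and adds the result to the pool; words may be reused arbitrarily often. For a nonempty word $w$ let $\mathrm{ASI}(w)$ be the least number of assembly steps after which $w$ is in the pool. ASI-DEC is the problem: given $(w,k)$ with $w\in\Sigma^+$ of length $n=|w|$ and $k\in\mathbb N$ encoded in binary (so that the input size is $n+\Theta(\log k)$), decide whether $\mathrm{ASI}(w)\le k$. Then ASI-DEC is in NP. More precisely, in addition to membership in NP (with respect to polynomial-time Turing machines), the following hold. (1) If $k\ge n-1$, then $(w,k)$ is a yes-instance. (2) If $k\le n-2$, then $(w,k)$ is a yes-instance if and only if there is an assembly plan of $t\le k$ steps $X_i:=U_i\circ V_i$ ($1\le i\le t$), in which each of $U_i,V_i$ is given by a pointer, either to a letter of $\Sigma$ or to some $X_j$ with $j<i$, and in which the last word $X_t$ equals $w$. Such plans can be encoded with $O(n\log n)$ bits. (3) Such plans can be checked in time $O(n^2)$: for each size of $\Sigma$ there are a program for a random access machine (instructions: constants, copying, addition, subtraction, indirect load and store, conditional jumps; each of unit cost) and a constant $C$ such that for every $(w,k)$ with $k\le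 n-2$ and every finite sequence of pairs of pointers (legal or not, of any length), the program, started with $(w,k)$ and this sequence in its memory, decides within $Cn^2$ steps whether the sequence is a plan for $w$ as in (2). No number that occurs in the computation exceeds the maximum of $Cn^2$ and the largest number in the input. -/

import Mathlib

/-! ### The assembly index of a word -/

namespace Assembly

/-- `Pool t P`: after `t` assembly steps the pool of available words can be `P`. Initially the pool
consists of the letters; a step joins two available words and adds the result to the pool. -/
inductive Pool {α : Type} : ℕ → Set (List α) → Prop
  | init : Pool 0 {x | ∃ a : α, x = [a]}
  | step {t : ℕ} {P : Set (List α)} {u v : List α} :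
      Pool t P → u ∈ P → v ∈ P → Pool (t + 1) (insert (u ++ v) P)

/-- The assembly index: the least number of assembly steps after which `w` is available
(it is `⊤` if `w` cannot be assembled, which only happens for the empty word). -/
noncomputable def asi {α : Type} (w : List α) : ℕ∞ :=
  ⨅ (t : ℕ) (_ : ∃ P : Set (List α), Pool t P ∧ w ∈ P), (t : ℕ∞)

/-- The yes-instances `(w, k)` of the decision problem: `w` is nonempty and `ASI(w) ≤ k`. -/
def ASIDec (α : Type) : Set (List α × ℕ) :=
  {x | x.1 ≠ [] ∧ asi x.1 ≤ (x.2 : ℕ∞)}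

/-- An instance as a string: the letters of `w`, followed by the binary digits of `k`
(least significant digit first). Its length is `|w|` plus the number of binary digits of `k`. -/
def encodeInstance {α : Type} (w : List α) (k : ℕ) : List (α ⊕ Bool) :=
  w.map Sum.inl ++ k.bits.map Sum.inr

/-- The decision problem as a formal language. -/
def asiDecLanguage (α : Type) : Language (α ⊕ Bool) :=
  {x | ∃ w k, (w, k) ∈ ASIDec α ∧ x = encodeInstance w k}

/-! ### Assembly plans given by pointers -/

/-- A pointer to a letter, or to the result of step number `j` (steps are numbered from `0`). -/
inductive Ptr (α : Type) : Type
  | letter (a : α) : Ptr α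
  | step (j : ℕ) : Ptr α

/-- A (raw) plan: the list of the pairs of pointers to the two words joined in each step.
Whether the pointers are legal is not part of the type. -/
abbrev Plan (α : Type) : Type := List (Ptr α × Ptr α)

/-- The word that a pointer refers to, if the results of the steps so far are `xs`. -/
def Ptr.resolve {α : Type} (xs : List (List α)) : Ptr α → Option (List α)
  | .letter a => some [a]
  | .step j => xs[j]?

/-- Carry out the remaining steps of a plan, the results of the steps so far being `xs`;
`none` if some pointer does not refer to an earlier step. -/
def Plan.evalFrom {α : Type} (xs : List (List α)) : Plan α → Option (List (List α))
  | [] => some xs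
  | (p, q) :: rest =>
    match p.resolve xs, q.resolve xs with
    | some u, some v => Plan.evalFrom (xs ++ [u ++ v]) rest
    | _, _ => none

/-- The plan is legal, and the word formed in its last step is `w`. -/
def Plan.Builds {α : Type} (p : Plan α) (w : List α) : Prop :=
  ∃ xs, Plan.evalFrom [] p = some xs ∧ xs.getLast? = some w

/-- The number that represents a pointer, for a numbering `e` of the alphabet. -/
def Ptr.code {α : Type} {s : ℕ} (e : α ≃ Fin s) : Ptr α → ℕ
  | .letter a => (e a : ℕ)
  | .step j => s + j

/-- A plan as a sequence of numbers, two for each step. -/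
def Plan.codes {α : Type} {s : ℕ} (e : α ≃ Fin s) (p : Plan α) : List ℕ :=
  p.flatMap fun x => [x.1.code e, x.2.code e]

/-- A plan as a bit string: each pointer of a `t`-step plan is written with as many bits as
`s + t` has (the pointers of a legal plan have codes below `s + t`). -/
def Plan.bits {α : Type} {s : ℕ} (e : α ≃ Fin s) (p : Plan α) : List Bool :=
  (Plan.codes e p).flatMap fun c => (List.range (Nat.size (s + p.length))).map fun i => c.testBit i

end Assembly

/-! ### The class NP, over Mathlib's multi-stack Turing machines -/

/-- `L` is in NP: there are a finite certificate alphabet, a polynomial bound on the length of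
certificates, and a verifier running in polynomial time on a Turing machine. -/
def InNP {Γ : Type} (L : Language Γ) : Prop :=
  ∃ (Δ : Type) (_ : Fintype Δ) (bound : Polynomial ℕ) (V : List Γ × List Δ → Bool),
    Nonempty (Turing.TM2ComputableInPolyTime
      (fun xy : List Γ × List Δ => xy.1.map Sum.inl ++ xy.2.map (Sum.inr : Δ → Γ ⊕ Δ))
      Computability.encodeBool V) ∧
    ∀ x : List Γ, x ∈ L ↔ ∃ y : List Δ, y.length ≤ bound.eval x.length ∧ V (x, y) = true

/-! ### Random access machines -/

namespace RAM

/-- Instructions; `d`, `a`, `b` are names of registers. There is no multiplication. -/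
inductive Instr : Type
  /-- `reg d := v` -/
  | const (d v : ℕ) : Instr
  /-- `reg d := reg a` -/
  | move (d a : ℕ) : Instr
  /-- `reg d := reg a + reg b` -/
  | add (d a b : ℕ) : Instr
  /-- `reg d := reg a - reg b`, truncated at `0` -/
  | sub (d a b : ℕ) : Instr
  /-- `reg d := mem (reg a)` -/
  | load (d a : ℕ) : Instr
  /-- `mem (reg a) := reg b` -/
  | store (a b : ℕ) : Instr
  /-- go to instruction `l` -/
  | jump (l : ℕ) : Instr
  /-- go to instruction `l` if `reg a < reg b` -/
  | jumpLT (a b l : ℕ) : Instr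
  /-- go to instruction `l` if `reg a = reg b` -/
  | jumpEQ (a b l : ℕ) : Instr
  /-- stop with the answer `ans` -/
  | halt (ans : Bool) : Instr

abbrev Program : Type := List Instr

/-- Program counter, registers, and memory. -/
structure Cfg : Type where
  pc : ℕ
  reg : ℕ → ℕ
  mem : ℕ → ℕ

/-- One step; `none` if the machine has stopped. -/
def step (P : Program) (c : Cfg) : Option Cfg :=
  match P[c.pc]? with
  | none => none
  | some (.const d v) => some ⟨c.pc + 1, Function.update c.reg d v, c.mem⟩
  | some (.move d a) => some ⟨c.pc + 1, Function.update c.reg d (c.reg a), c.mem⟩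
  | some (.add d a b) => some ⟨c.pc + 1, Function.update c.reg d (c.reg a + c.reg b), c.mem⟩
  | some (.sub d a b) => some ⟨c.pc + 1, Function.update c.reg d (c.reg a - c.reg b), c.mem⟩
  | some (.load d a) => some ⟨c.pc + 1, Function.update c.reg d (c.mem (c.reg a)), c.mem⟩
  | some (.store a b) => some ⟨c.pc + 1, c.reg, Function.update c.mem (c.reg a) (c.reg b)⟩
  | some (.jump l) => some ⟨l, c.reg, c.mem⟩
  | some (.jumpLT a b l) => some ⟨if c.reg a < c.reg b then l else c.pc + 1, c.reg, c.mem⟩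
  | some (.jumpEQ a b l) => some ⟨if c.reg a = c.reg b then l else c.pc + 1, c.reg, c.mem⟩
  | some (.halt _) => none

/-- The start: all registers are `0`, the memory holds the input from address `0` on, and is `0`
elsewhere. -/
def init (input : List ℕ) : Cfg := ⟨0, fun _ => 0, fun i => input.getD i 0⟩

/-- The configuration after `m` steps, if the machine makes that many. -/
def run (P : Program) (input : List ℕ) (m : ℕ) : Option Cfg :=
  (fun o => o.bind (step P))^[m] (some (init input))

/-- Within `T` steps the program stops with the answer whether `φ` holds. -/
def DecidesWithin (P : Program) (input : List ℕ) (φ : Prop) (T : ℕ) : Prop :=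
  ∃ m ≤ T, ∃ c : Cfg, ∃ ans : Bool,
    run P input m = some c ∧ P[c.pc]? = some (.halt ans) ∧ (ans = true ↔ φ)

/-- No register and no memory cell (hence also no address) ever exceeds `W`. -/
def WordsBoundedBy (P : Program) (input : List ℕ) (W : ℕ) : Prop :=
  ∀ m c, run P input m = some c → (∀ i, c.reg i ≤ W) ∧ ∀ i, c.mem i ≤ W

end RAM

namespace Assembly

/-- The input of a verifier that runs on a random access machine: the length of `w`, the bound `k`,
the number of steps of the plan, the letters of `w`, and the pointers of the plan. -/
def verifierInput {α : Type} {s : ℕ} (e : α ≃ Fin s) (w : List α) (k : ℕ) (p : Plan α) : List ℕ :=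
  [w.length, k, p.length] ++ w.map (fun a => (e a : ℕ)) ++ Plan.codes e p

end Assembly

/-! A word of length `n` can be assembled letter by letter in `n - 1` steps. A concatenation is
never shorter than its parts, so words longer than `w` can be dropped from any assembly of `w`.
Hence, however large the binary number `k` is, a yes-instance has a witness with at most `n`
intermediate words, each of length at most `n` (`exists_assembled_of_asi_le`).

For membership in NP the certificate is a script of elementary commands: move a head over the words
assembled so far, copy one, write the new word, borrow one unit from the binary counter `k`. The
verifier does a bounded amount of work per symbol, so it is a real-time stack machine, and any such
machine is simulated by a `TM2` machine in linear time (`StackMachine.computableInPolyTime`).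
Soundness is an invariant that holds for arbitrary scripts: the words on the tape have been
assembled, and their number plus what is left on the counter is at most `k` (`Invariant.exec`,
`sound`). Completeness is an explicit script whose length is polynomial in the input length
(`reach_assembled`, `complete`).

If `k ≤ n - 2`, then `w` has at least two letters, so it is the result of some step, and an assembly
can be cut off there; recording where the two parts of each word come from gives a plan
(`mem_asiDec_iff_exists_plan`). To check a plan, the random access machine verifies that pointers
lead backwards and then expands the last step depth first on a stack of pointers, matching letters
against `w`. The word of a plan can be exponentially long, but every pointer on the stack stands for
a nonempty word, so the run is aborted as soon as matched letters plus stack height exceed `n`.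
Under this restriction (twice the letters matched) + (stack height) never exceeds `2n` and grows by
one in each round, which even gives a linear time bound (`halts_expand`, `halts_verifier`). -/

/-! ### Real-time stack machines and their simulation on `TM2` machines -/

/-- A deterministic machine with finitely many stacks that reads its input once, and in each step
replaces the top symbols of its stacks by at most two symbols each. -/
structure StackMachine (A : Type) where
  Q : Type
  K : Type
  S : K → Type
  [finQ : Fintype Q]
  [finK : Fintype K]
  [decK : DecidableEq K]
  [finS : ∀ k, Fintype (S k)]
  start : Q
  next : Q → A → (∀ k, List (S k)) → Q × ∀ k, List (S k)
  acc : Q → Bool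
  /-- The step depends only on the tops of the stacks and leaves what is below unchanged. -/
  next_eq : ∀ q a s, next q a s = ((next q a fun k => (s k).take 1).1,
    fun k => (next q a fun k => (s k).take 1).2 k ++ (s k).drop 1)
  length_next_le : ∀ q a s, (∀ k, (s k).length ≤ 1) → ∀ k, ((next q a s).2 k).length ≤ 2

namespace StackMachine

open Turing Function

variable {A : Type} (M : StackMachine A)

instance : Fintype M.Q := M.finQ
instance : Fintype M.K := M.finK
instance : DecidableEq M.K := M.decK
instance (k : M.K) : Fintype (M.S k) := M.finS k

/-- The configuration after reading `x`. -/
def runFrom (c : M.Q × ∀ k, List (M.S k)) (x : List A) : M.Q × ∀ k, List (M.S k) :=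
  x.foldl (fun c a => M.next c.1 a c.2) c

def accepts (x : List A) : Bool := M.acc (M.runFrom (M.start, fun _ => []) x).1

/-- The stacks of the simulating machine: input, output, and the stacks of `M`. -/
abbrev Gam : Option (Option M.K) → Type
  | none => A
  | some none => Bool
  | some (some k) => M.S k

/-- The internal state of the simulating machine: the state of `M`, the symbol just read, and the
symbols popped from the stacks. -/
structure Var where
  q : M.Q
  a : Option A
  tops : ∀ k, Option (M.S k)

noncomputable instance [Fintype A] : Fintype M.Var := by
  classical
  exact Fintype.ofInjective
    (fun v : M.Var => ((v.q, v.a, v.tops) : M.Q × Option A × ∀ k, Option (M.S k)))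
    fun v w h => by cases v; cases w; simpa using h

abbrev St : Type := TM2.Stmt M.Gam (Option Bool) M.Var

def popAll : List M.K → M.St → M.St
  | [], q => q
  | k :: l, q =>
    .pop (some (some k)) (fun v t => { v with tops := update v.tops k t }) (popAll l q)

-- A `push` statement needs a total function into `S k`, so an optional push becomes a branch with a
-- dummy default. If `S k` is empty there is never anything to push.
open Classical in
noncomputable def pushOpt (k : M.K) (g : M.Var → Option (M.S k)) (q : M.St) : M.St :=
  if h : Nonempty (M.S k) then
    .branch (fun v => (g v).isSome) (.push (some (some k)) (fun v => (g v).getD h.some) q) q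
  else q

noncomputable def pushAll (r : M.Var → ∀ k, List (M.S k)) : List M.K → M.St → M.St
  | [], q => q
  | k :: l, q =>
    -- The second symbol is pushed first, so that the head of the list ends up on top.
    M.pushOpt k (fun v => (r v k)[1]?) (M.pushOpt k (fun v => (r v k)[0]?) (pushAll r l q))

/-- The contents of the stacks of the simulating machine. -/
def stk (x : List A) (o : List Bool) (s : ∀ k, List (M.S k)) : ∀ k, List (M.Gam k)
  | none => x
  | some none => o
  | some (some k) => s k

theorem update_stk (x : List A) (o : List Bool) (s : ∀ k, List (M.S k)) (k : M.K)
    (l : List (M.S k)) :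
    update (M.stk x o s) (some (some k)) l = M.stk x o (update s k l) := by
  funext j
  match j with
  | none => rfl
  | some none => rfl
  | some (some j) =>
    by_cases h : j = k
    · subst h; simp [stk]
    · simp [stk, update_of_ne, h]

theorem update_stk_input (x y : List A) (o : List Bool) (s : ∀ k, List (M.S k)) :
    update (M.stk x o s) none y = M.stk y o s := by
  funext j
  match j with
  | none => simp [stk]
  | some none => simp [stk]
  | some (some j) => simp [stk]

theorem update_stk_output (x : List A) (o p : List Bool) (s : ∀ k, List (M.S k)) :
    update (M.stk x o s) (some none) p = M.stk x p s := by
  funext j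
  match j with
  | none => simp [stk]
  | some none => simp [stk]
  | some (some j) => simp [stk]

theorem stepAux_popAll (l : List M.K) (hl : l.Nodup) (q : M.St) (v : M.Var) (x : List A)
    (o : List Bool) (s : ∀ k, List (M.S k)) :
    TM2.stepAux (M.popAll l q) v (M.stk x o s) =
      TM2.stepAux q ⟨v.q, v.a, fun k => if k ∈ l then (s k).head? else v.tops k⟩
        (M.stk x o fun k => if k ∈ l then (s k).tail else s k) := by
  induction l generalizing v s with
  | nil => simp [popAll]
  | cons k l ih =>
    rw [List.nodup_cons] at hl
    rw [popAll, TM2.stepAux, update_stk, ih hl.2]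
    congr 2
    · funext j
      by_cases h : j = k
      · subst h; simp [hl.1, stk]
      · simp [h]
    · funext j
      by_cases h : j = k
      · subst h; simp [hl.1, stk]
      · simp [h]

theorem stepAux_pushOpt (k : M.K) (g : M.Var → Option (M.S k)) (q : M.St) (v : M.Var) (x : List A)
    (o : List Bool) (s : ∀ k, List (M.S k)) :
    TM2.stepAux (M.pushOpt k g q) v (M.stk x o s) =
      TM2.stepAux q v (M.stk x o (update s k ((g v).toList ++ s k))) := by
  unfold pushOpt
  split_ifs with h
  · rw [TM2.stepAux]
    cases hg : g v with
    | none => simp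
    | some a =>
      simp only [Option.isSome_some, cond_true, TM2.stepAux, update_stk, hg]
      rfl
  · have : g v = none := by
      cases hg : g v with
      | none => rfl
      | some a => exact absurd ⟨a⟩ h
    simp [this]

theorem stepAux_pushAll (r : M.Var → ∀ k, List (M.S k)) (l : List M.K) (hl : l.Nodup) (q : M.St)
    (v : M.Var) (hr : ∀ k, (r v k).length ≤ 2) (x : List A)
    (o : List Bool) (s : ∀ k, List (M.S k)) :
    TM2.stepAux (M.pushAll r l q) v (M.stk x o s) =
      TM2.stepAux q v (M.stk x o fun k => if k ∈ l then r v k ++ s k else s k) := by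
  induction l generalizing s with
  | nil => simp [pushAll]
  | cons k l ih =>
    rw [List.nodup_cons] at hl
    rw [pushAll, stepAux_pushOpt, stepAux_pushOpt, ih hl.2]
    congr 2
    funext j
    by_cases h : j = k
    · subst h
      have := hr j
      rcases hj : r v j with _ | ⟨a, _ | ⟨b, _ | _⟩⟩ <;> simp_all
    · simp [h]

/-- The step of `M`, as a function of the popped symbols. -/
def result (v : M.Var) : M.Q × ∀ k, List (M.S k) :=
  match v.a with
  | none => (v.q, fun _ => [])
  | some a => M.next v.q a fun k => (v.tops k).toList

noncomputable def allK : List M.K := Finset.univ.toList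

theorem mem_allK (k : M.K) : k ∈ M.allK := by simp [allK]

theorem nodup_allK : M.allK.Nodup := Finset.nodup_toList _

open Classical in
/-- The program: the main loop, and the loop that empties the stacks. -/
noncomputable def prog : Option Bool → M.St
  | none =>
    .pop none (fun v t => { v with a := t }) <|
      .branch (fun v => v.a.isNone) (.goto fun v => some (M.acc v.q)) <|
        M.popAll M.allK <|
          M.pushAll (fun v => (M.result v).2) M.allK <|
            .load (fun v => ⟨(M.result v).1, none, fun _ => none⟩) <|
              .goto fun _ => none
  -- The output convention demands the initial internal state and empty stacks apart from the
  -- answer, so the stacks of `M` are drained before halting.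
  | some b =>
    M.popAll M.allK <|
      .branch (fun v => decide (∀ k, v.tops k = none))
        (.load (fun _ => ⟨M.start, none, fun _ => none⟩) <|
          .push (some none) (fun _ => b) .halt)
        (.goto fun _ => some b)

/-- The simulating machine. -/
noncomputable def toTM2 [Fintype A] : FinTM2 where
  K := Option (Option M.K)
  k₀ := none
  k₁ := some none
  Γ := M.Gam
  Λ := Option Bool
  main := none
  σ := M.Var
  initialState := ⟨M.start, none, fun _ => none⟩
  Γk₀Fin := inferInstanceAs (Fintype A)
  m := M.prog

/-! ### Running time of the simulation -/

noncomputable abbrev tstep : TM2.Cfg M.Gam (Option Bool) M.Var → Option (TM2.Cfg M.Gam (Option Bool) M.Var) :=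
  TM2.step M.prog

/-- A `TM2` step executes a whole statement up to the next `goto`, so popping all tops and pushing
their replacements counts as a single step. -/
theorem tstep_read (a : A) (x : List A) (q : M.Q) (s : ∀ k, List (M.S k)) :
    M.tstep ⟨some none, ⟨q, none, fun _ => none⟩, M.stk (a :: x) [] s⟩ =
      some ⟨some none, ⟨(M.next q a s).1, none, fun _ => none⟩,
        M.stk x [] (M.next q a s).2⟩ := by
  have hs : (fun k => (s k).take 1) = fun k => (s k).head?.toList := by
    funext k; cases s k <;> simp
  have hlen : ∀ k, ((M.next q a fun k => (s k).take 1).2 k).length ≤ 2 :=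
    M.length_next_le q a _ fun k => by simp
  rw [tstep, TM2.step, prog, TM2.stepAux, TM2.stepAux]
  simp only [stk, List.head?_cons, Option.isNone_some, cond_false, List.tail_cons]
  rw [update_stk_input, stepAux_popAll _ _ M.nodup_allK, stepAux_pushAll _ _ _ M.nodup_allK]
  · rw [M.next_eq q a s]
    simp only [mem_allK, if_true, TM2.stepAux, result, hs]
    simp [List.drop_one]
  · intro k
    simpa only [mem_allK, if_true, result, hs] using hlen k

theorem tstep_end (q : M.Q) (s : ∀ k, List (M.S k)) :
    M.tstep ⟨some none, ⟨q, none, fun _ => none⟩, M.stk [] [] s⟩ =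
      some ⟨some (some (M.acc q)), ⟨q, none, fun _ => none⟩, M.stk [] [] s⟩ := by
  rw [tstep, TM2.step, prog, TM2.stepAux, TM2.stepAux]
  simp [stk, update_stk_input]

theorem tstep_clean (b : Bool) (v : M.Var) (s : ∀ k, List (M.S k)) :
    M.tstep ⟨some (some b), v, M.stk [] [] s⟩ =
      if ∀ k, s k = [] then
        some ⟨none, ⟨M.start, none, fun _ => none⟩, M.stk [] [b] fun _ => []⟩
      else some ⟨some (some b), ⟨v.q, v.a, fun k => (s k).head?⟩,
        M.stk [] [] fun k => (s k).tail⟩ := by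
  rw [tstep, TM2.step, prog, stepAux_popAll _ _ M.nodup_allK]
  simp only [mem_allK, if_true, TM2.stepAux, List.head?_eq_none_iff]
  split_ifs with h
  · simp only [h, implies_true, decide_true, cond_true, List.tail_nil]
    rw [update_stk_output]
    rfl
  · simp [h]

theorem evals_clean (b : Bool) (v : M.Var) (m : ℕ) (s : ∀ k, List (M.S k))
    (hs : ∀ k, (s k).length ≤ m) :
    ∃ n ≤ m + 1, (flip bind M.tstep)^[n] (some ⟨some (some b), v, M.stk [] [] s⟩) =
      some ⟨none, ⟨M.start, none, fun _ => none⟩, M.stk [] [b] fun _ => []⟩ := by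
  induction m generalizing v s with
  | zero =>
    refine ⟨1, le_rfl, ?_⟩
    have : ∀ k, s k = [] := fun k => by simpa using hs k
    simpa [flip, this] using M.tstep_clean b v s
  | succ m ih =>
    have hc := M.tstep_clean b v s
    split_ifs at hc with h
    · exact ⟨1, by omega, by simpa [flip] using hc⟩
    · obtain ⟨n, hn, e⟩ := ih ⟨v.q, v.a, fun k => (s k).head?⟩ (fun k => (s k).tail) fun k => by
        have := hs k
        simp only [List.length_tail]; omega
      refine ⟨n + 1, by omega, ?_⟩
      rw [iterate_succ_apply, ← e]
      congr 1

theorem length_next (q : M.Q) (a : A) (s : ∀ k, List (M.S k)) (m : ℕ)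
    (hs : ∀ k, (s k).length ≤ m) (k : M.K) : ((M.next q a s).2 k).length ≤ m + 2 := by
  rw [M.next_eq]
  have h1 := M.length_next_le q a (fun k => (s k).take 1) (fun k => by simp) k
  have h2 := hs k
  simp only [List.length_append, List.length_drop]
  omega

/-- Each input symbol costs one step for reading and at most two later steps of draining, because it
raises the height bound `m` by `2`. Noticing the end of the input and draining take `m + 2` more. -/
theorem evals_run (x : List A) (q : M.Q) (s : ∀ k, List (M.S k)) (m : ℕ)
    (hs : ∀ k, (s k).length ≤ m) :
    ∃ n ≤ 3 * x.length + m + 2,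
      (flip bind M.tstep)^[n] (some ⟨some none, ⟨q, none, fun _ => none⟩, M.stk x [] s⟩) =
      some ⟨none, ⟨M.start, none, fun _ => none⟩,
        M.stk [] [M.acc (M.runFrom (q, s) x).1] fun _ => []⟩ := by
  induction x generalizing q s m with
  | nil =>
    obtain ⟨n, hn, e⟩ := M.evals_clean (M.acc q) ⟨q, none, fun _ => none⟩ m s hs
    refine ⟨n + 1, by simp; omega, ?_⟩
    rw [iterate_succ_apply]
    simp only [flip, bind, Option.bind_some, tstep_end] at e ⊢
    exact e
  | cons a x ih =>
    obtain ⟨n, hn, e⟩ := ih (M.next q a s).1 (M.next q a s).2 (m + 2) (M.length_next q a s m hs)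
    refine ⟨n + 1, by simp; omega, ?_⟩
    rw [iterate_succ_apply]
    simp only [flip, bind, Option.bind_some, tstep_read] at e ⊢
    exact e

/-- Acceptance by a real-time stack machine is decided in polynomial time. -/
noncomputable def computableInPolyTime [Fintype A] {β : Type} (enc : β → List A) :
    TM2ComputableInPolyTime enc Computability.encodeBool fun x => M.accepts (enc x) where
  tm := M.toTM2
  inputAlphabet := Equiv.refl A
  outputAlphabet := Equiv.refl Bool
  time := 3 * Polynomial.X + 2
  outputsFun x := by
    have h := M.evals_run (enc x) M.start (fun _ => []) 0 (by simp)
    have hi : initList M.toTM2 (List.map (Equiv.refl A).invFun (enc x)) =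
        ⟨some none, ⟨M.start, none, fun _ => none⟩, M.stk (enc x) [] fun _ => []⟩ := by
      unfold initList
      congr 1
      funext k
      match k with
      | none => simp [stk, toTM2]; rfl
      | some none => rfl
      | some (some k) => rfl
    have ho (b : Bool) : haltList M.toTM2 (List.map (Equiv.refl Bool).invFun [b]) =
        ⟨none, ⟨M.start, none, fun _ => none⟩, M.stk [] [b] fun _ => []⟩ := by
      unfold haltList
      congr 1
      funext k
      match k with
      | none => rfl
      | some none => rfl
      | some (some k) => rfl
    refine ⟨⟨h.choose, ?_⟩, ?_⟩
    · refine Eq.trans ?_ (h.choose_spec.2.trans ?_)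
      · exact congrArg _ (congrArg _ hi)
      · exact (congrArg some (ho _)).symm
    · have := h.choose_spec.1
      simp only [Polynomial.eval_add, Polynomial.eval_mul, Polynomial.eval_X,
        Polynomial.eval_ofNat]
      omega

end StackMachine

/-! ### Assembly sequences -/

namespace Assembly

variable {α : Type}

/-- `u` is a letter or belongs to `ws`. -/
def Avail (ws : List (List α)) (u : List α) : Prop := u ∈ ws ∨ ∃ a, u = [a]

/-- `ws` is the list of the results of some assembly steps, the last one first. -/
inductive Assembled : List (List α) → Prop
  | nil : Assembled []
  | cons {ws : List (List α)} {u v : List α} :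
      Assembled ws → Avail ws u → Avail ws v → Assembled ((u ++ v) :: ws)

theorem Avail.cons {ws : List (List α)} {u : List α} (h : Avail ws u) (v : List α) :
    Avail (v :: ws) u :=
  h.imp (List.mem_cons_of_mem _) id

theorem Assembled.ne_nil {ws : List (List α)} (h : Assembled ws) {u : List α} (hu : Avail ws u) :
    u ≠ [] := by
  induction h generalizing u with
  | nil =>
    rcases hu with hu | ⟨a, rfl⟩
    · simp at hu
    · simp
  | cons _ h1 _ ih =>
    rcases hu with hu | ⟨a, rfl⟩
    · rcases List.mem_cons.1 hu with rfl | hu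
      · simp [ih h1]
      · exact ih (Or.inl hu)
    · simp

/-- The set forgets how many steps were made if a word is formed twice; the list keeps the count. -/
theorem pool_iff {t : ℕ} {P : Set (List α)} :
    Pool t P ↔ ∃ ws, Assembled ws ∧ ws.length = t ∧ P = {u | Avail ws u} := by
  constructor
  · intro h
    induction h with
    | init => exact ⟨[], .nil, rfl, by simp [Avail]⟩
    | step _ hu hv ih =>
      obtain ⟨ws, h, rfl, rfl⟩ := ih
      refine ⟨_, .cons h hu hv, rfl, ?_⟩
      ext x
      simp [Avail, or_assoc]
  · rintro ⟨ws, h, rfl, rfl⟩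
    induction h with
    | nil => simpa [Avail] using Pool.init (α := α)
    | @cons ws u v _ hu hv ih =>
      have := ih.step (u := u) (v := v) hu hv
      rw [List.length_cons]
      convert this using 1
      ext x
      simp [Avail, or_assoc]

theorem asi_le_iff {w : List α} {k : ℕ} :
    asi w ≤ k ↔ ∃ ws, Assembled ws ∧ ws.length ≤ k ∧ Avail ws w := by
  constructor
  · intro h
    have hlt : asi w < ((k + 1 : ℕ) : ℕ∞) := lt_of_le_of_lt h (by exact_mod_cast Nat.lt_succ_self k)
    simp only [asi, iInf_lt_iff] at hlt
    obtain ⟨t, ⟨P, hP, hw⟩, ht⟩ := hlt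
    obtain ⟨ws, h, rfl, rfl⟩ := pool_iff.1 hP
    exact ⟨ws, h, Nat.lt_succ_iff.1 (by exact_mod_cast ht), hw⟩
  · rintro ⟨ws, h, hk, hw⟩
    refine (iInf₂_le ws.length ⟨_, pool_iff.2 ⟨ws, h, rfl, rfl⟩, hw⟩).trans ?_
    exact_mod_cast hk

theorem exists_assembled_length_add_one {w : List α} (hw : w ≠ []) :
    ∃ ws, Assembled ws ∧ ws.length + 1 = w.length ∧ Avail ws w := by
  induction w with
  | nil => exact absurd rfl hw
  | cons a w ih =>
    rcases eq_or_ne w [] with rfl | h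
    · exact ⟨[], .nil, rfl, .inr ⟨a, rfl⟩⟩
    · obtain ⟨ws, h1, h2, h3⟩ := ih h
      exact ⟨_, h1.cons (.inr ⟨a, rfl⟩) h3, by simp [h2], .inl (by simp)⟩

/-- Words that are too long can be left out. -/
theorem Assembled.truncate {ws : List (List α)} (h : Assembled ws) (n : ℕ) :
    ∃ ws', Assembled ws' ∧ ws'.length ≤ ws.length ∧ (∀ u ∈ ws', u.length ≤ n) ∧
      ∀ u, Avail ws u → u.length ≤ n → Avail ws' u := by
  induction h with
  | nil => exact ⟨[], .nil, le_rfl, by simp, fun u hu _ => hu⟩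
  | @cons ws u v _ hu hv ih =>
    obtain ⟨ws', h1, h2, h3, h4⟩ := ih
    by_cases hn : (u ++ v).length ≤ n
    · have hn' := hn
      rw [List.length_append] at hn'
      refine ⟨_, h1.cons (h4 u hu (by omega)) (h4 v hv (by omega)), by simpa, ?_, ?_⟩
      · simpa using ⟨by simpa using hn, h3⟩
      · rintro x (hx | hx) hxn
        · rcases List.mem_cons.1 hx with rfl | hx
          · exact .inl (by simp)
          · exact (h4 x (.inl hx) hxn).cons _
        · exact .inr hx
    · refine ⟨ws', h1, by simp; omega, h3, ?_⟩
      rintro x (hx | hx) hxn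
      · rcases List.mem_cons.1 hx with rfl | hx
        · exact absurd hxn hn
        · exact h4 x (.inl hx) hxn
      · exact .inr hx

theorem exists_assembled_of_asi_le {w : List α} {k : ℕ} (hw : w ≠ []) (h : asi w ≤ k) :
    ∃ ws, Assembled ws ∧ ws.length ≤ k ∧ ws.length ≤ w.length ∧ (∀ u ∈ ws, u.length ≤ w.length) ∧
      Avail ws w := by
  -- Since `k` is given in binary it may be exponential in the input length; the letter by letter
  -- assembly caps the number of steps by the length of `w`.
  have : asi w ≤ (min k w.length : ℕ) := by
    obtain ⟨ws, h1, h2, h3⟩ := exists_assembled_length_add_one hw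
    rcases min_choice k w.length with e | e <;> rw [e]
    · exact h
    · exact asi_le_iff.2 ⟨ws, h1, by omega, h3⟩
  obtain ⟨ws, h1, h2, h3⟩ := asi_le_iff.1 this
  obtain ⟨ws', h4, h5, h6, h7⟩ := h1.truncate w.length
  have := le_min_iff.1 h2
  exact ⟨ws', h4, by omega, by omega, h6, h7 w h3 le_rfl⟩

/-- The newest word comes first, so everything from an occurrence of `w` on is itself an assembly
sequence, with `w` as its last result. -/
theorem Assembled.exists_last {ws : List (List α)} (h : Assembled ws) {w : List α} (hw : w ∈ ws) :
    ∃ ws', Assembled (w :: ws') ∧ ws'.length + 1 ≤ ws.length := by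
  induction h with
  | nil => simp at hw
  | @cons ws u v h hu hv ih =>
    rcases List.mem_cons.1 hw with rfl | hw
    · exact ⟨ws, h.cons hu hv, le_rfl⟩
    · obtain ⟨ws', h1, h2⟩ := ih hw
      exact ⟨ws', h1, by simp; omega⟩

theorem mem_asiDec_of_length_le {w : List α} {k : ℕ} (hw : w ≠ []) (hk : w.length ≤ k + 1) :
    (w, k) ∈ ASIDec α := by
  obtain ⟨ws, h1, h2, h3⟩ := exists_assembled_length_add_one hw
  exact ⟨hw, asi_le_iff.2 ⟨ws, h1, by omega, h3⟩⟩

/-! ### Plans -/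

theorem Ptr.avail_of_resolve {ws : List (List α)} {p : Ptr α} {u : List α}
    (h : p.resolve ws.reverse = some u) : Avail ws u := by
  cases p with
  | letter a => exact .inr ⟨a, (Option.some.inj h).symm⟩
  | step j => exact .inl (by simpa using List.mem_of_getElem? h)

theorem Avail.exists_resolve {ws : List (List α)} {u : List α} (h : Avail ws u) :
    ∃ p : Ptr α, p.resolve ws.reverse = some u := by
  rcases h with h | ⟨a, rfl⟩
  · obtain ⟨j, hj⟩ := List.mem_iff_getElem?.1 (List.mem_reverse.2 h)
    exact ⟨.step j, hj⟩
  · exact ⟨.letter a, rfl⟩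

theorem Plan.evalFrom_append (xs : List (List α)) (p q : Plan α) :
    Plan.evalFrom xs (p ++ q) = (Plan.evalFrom xs p).bind fun ys => Plan.evalFrom ys q := by
  induction p generalizing xs with
  | nil => rfl
  | cons x p ih =>
    obtain ⟨a, b⟩ := x
    simp only [List.cons_append, Plan.evalFrom]
    cases a.resolve xs <;> cases b.resolve xs <;> simp [ih]

theorem Assembled.exists_plan {ws : List (List α)} (h : Assembled ws) :
    ∃ p : Plan α, p.length = ws.length ∧ Plan.evalFrom [] p = some ws.reverse := by
  induction h with
  | nil => exact ⟨[], rfl, rfl⟩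
  | @cons ws u v h hu hv ih =>
    obtain ⟨p, hp, e⟩ := ih
    obtain ⟨a, ha⟩ := hu.exists_resolve
    obtain ⟨b, hb⟩ := hv.exists_resolve
    refine ⟨p ++ [(a, b)], by simp [hp], ?_⟩
    rw [Plan.evalFrom_append, e]
    simp [Plan.evalFrom, ha, hb]

theorem Assembled.of_evalFrom {ws : List (List α)} (h : Assembled ws) {p : Plan α}
    {xs : List (List α)} (e : Plan.evalFrom ws.reverse p = some xs) :
    Assembled xs.reverse ∧ xs.length = ws.length + p.length := by
  induction p generalizing ws with
  | nil => obtain rfl := Option.some.inj e; simpa using h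
  | cons x p ih =>
    obtain ⟨a, b⟩ := x
    rw [Plan.evalFrom] at e
    split at e
    · rename_i u v hu hv
      have := ih (h.cons (Ptr.avail_of_resolve hu) (Ptr.avail_of_resolve hv)) (by simpa using e)
      exact ⟨this.1, by simp [this.2]; omega⟩
    · simp at e

theorem mem_asiDec_iff_exists_plan {w : List α} {k : ℕ} (hk : k + 2 ≤ w.length) :
    (w, k) ∈ ASIDec α ↔ ∃ p : Plan α, p.length ≤ k ∧ p.Builds w := by
  have hw : w ≠ [] := by rintro rfl; simp at hk
  constructor
  · rintro ⟨-, h⟩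
    obtain ⟨ws, h1, h2, h3⟩ := asi_le_iff.1 h
    rcases h3 with h3 | ⟨a, rfl⟩
    · obtain ⟨ws', h4, h5⟩ := h1.exists_last h3
      obtain ⟨p, hp, e⟩ := h4.exists_plan
      exact ⟨p, by simp at hp; omega, _, e, by simp⟩
    · simp at hk
  · rintro ⟨p, hp, xs, e, hl⟩
    obtain ⟨h1, h2⟩ := Assembled.nil.of_evalFrom (p := p) (xs := xs) e
    refine ⟨hw, asi_le_iff.2 ⟨_, h1, by simp at h2 ⊢; omega, .inl ?_⟩⟩
    simpa using List.mem_of_getLast? hl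

/-! ### A real-time stack machine that verifies assembly sequences -/

namespace Verifier

/-- The commands of a certificate. -/
inductive Cmd (α : Type) : Type
  | lower | raise | take | give
  | left | right
  | letter (a : α)
  | beginCopy | endCopy
  | insert | put | finish
  | compare | check | accept
  deriving Fintype

/-- `word` and `num` belong to the reading of the instance; `free i` means that `i` of the two parts
of a new word have been collected, `copy i` that part number `i` is being copied. -/
inductive Mode : Type
  | word | num (b : Bool) | free0 | free1 | free2 | copy0 | copy1 | ins | cmp | done | dead
  deriving Fintype

/-- The configurations: `A` and `B` hold the lower and the higher digits of a counter, `held` is a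
unit at the position between them; `L` and `R` hold the words assembled so far to the left and to
the right of a head, `N` the new word (reversed), and `W` the word `w` (reversed). -/
structure Conf (α : Type) : Type where
  mode : Mode
  held : Bool
  A : List Bool
  B : List Bool
  L : List (Option α)
  R : List (Option α)
  N : List α
  W : List α

def Mode.isFree : Mode → Bool
  | free0 | free1 | free2 => true
  | _ => false

def Mode.isCopy : Mode → Bool
  | copy0 | copy1 => true
  | _ => false

/-- The head is not inside a word. -/
def AtBoundary : List (Option α) → Bool
  | some _ :: _ => false
  | _ => true

open Classical in
/-- The execution of a command; commands that are not applicable are ignored. -/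
noncomputable def exec (c : Conf α) : Cmd α → Conf α
  | .lower =>
    match c.A with
    | d :: A => { c with A := A, B := d :: c.B }
    | [] => c
  | .raise =>
    match c.held, c.B with
    | false, d :: B => { c with A := d :: c.A, B := B }
    | _, _ => c
  | .take =>
    match c.held, c.B with
    | false, true :: B => { c with held := true, B := false :: B }
    | _, _ => c
  | .give =>
    match c.held, c.A with
    | true, false :: A => { c with A := A, B := true :: c.B }
    | _, _ => c
  | .left =>
    match c.mode.isFree, c.L with
    | true, x :: L => { c with L := L, R := x :: c.R }
    | _, _ => c
  | .right =>
    match c.R with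
    | some a :: R =>
      if c.mode.isFree then { c with L := some a :: c.L, R := R }
      else if c.mode.isCopy then { c with L := some a :: c.L, R := R, N := a :: c.N }
      else c
    | none :: R => if c.mode.isFree then { c with L := none :: c.L, R := R } else c
    | [] => c
  | .letter a =>
    match c.mode with
    | .free0 => { c with mode := .free1, N := a :: c.N }
    | .free1 => { c with mode := .free2, N := a :: c.N }
    | _ => c
  | .beginCopy =>
    match c.mode, c.R with
    | .free0, none :: R => { c with mode := .copy0, L := none :: c.L, R := R }
    | .free1, none :: R => { c with mode := .copy1, L := none :: c.L, R := R }
    | _, _ => c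
  | .endCopy =>
    match c.mode, AtBoundary c.R with
    | .copy0, true => { c with mode := .free1 }
    | .copy1, true => { c with mode := .free2 }
    | _, _ => c
  | .insert =>
    match c.mode, c.held, AtBoundary c.R with
    | .free2, true, true => { c with mode := .ins, held := false }
    | _, _, _ => c
  | .put =>
    match c.mode, c.N with
    | .ins, a :: N => { c with R := some a :: c.R, N := N }
    | _, _ => c
  | .finish =>
    match c.mode, c.N with
    | .ins, [] => { c with mode := .free0, R := none :: c.R }
    | _, _ => c
  | .compare =>
    match c.mode with
    | .free1 => { c with mode := .cmp }
    | _ => c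
  | .check =>
    match c.mode, c.N, c.W with
    | .cmp, a :: N, b :: W => if a = b then { c with N := N, W := W } else c
    | _, _, _ => c
  | .accept =>
    match c.mode, c.N, c.W with
    | .cmp, [], [] => { c with mode := .done }
    | _, _, _ => c

/-- The reaction to an input symbol: a letter of `w`, a digit of `k`, or a command. -/
noncomputable def step (c : Conf α) : (α ⊕ Bool) ⊕ Cmd α → Conf α
  | .inl (.inl a) =>
    match c.mode with
    | .word => { c with W := a :: c.W }
    | _ => { c with mode := .dead }
  | .inl (.inr b) =>
    match c.mode with
    | .word | .num _ => { c with mode := .num b, A := b :: c.A }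
    | _ => { c with mode := .dead }
  | .inr x =>
    match c.mode with
    | .word | .num true => { c with mode := .free0 }
    | .num false | .dead => c
    | _ => exec c x

def initial : Conf α := ⟨.word, false, [], [], [], [], [], []⟩

/-! #### The machine is a stack machine -/

/-- The configuration with only the top symbols of the stacks. -/
def Conf.top (c : Conf α) : Conf α :=
  ⟨c.mode, c.held, c.A.take 1, c.B.take 1, c.L.take 1, c.R.take 1, c.N.take 1, c.W.take 1⟩

/-- `c` on top of what is below the top symbols in `d`. -/
def Conf.over (c d : Conf α) : Conf α :=
  ⟨c.mode, c.held, c.A ++ d.A.drop 1, c.B ++ d.B.drop 1, c.L ++ d.L.drop 1, c.R ++ d.R.drop 1,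
    c.N ++ d.N.drop 1, c.W ++ d.W.drop 1⟩

theorem take_one_append_tail {β : Type} (l : List β) : l.take 1 ++ l.tail = l := by
  cases l <;> simp

/-- Every command inspects and changes only the tops of the stacks; this locality is what `next_eq`
asks for. -/
theorem exec_top_over (c : Conf α) (x : Cmd α) : (exec c.top x).over c = exec c x := by
  obtain ⟨m, h, A, B, L, R, N, W⟩ := c
  cases x with
  | lower => cases A <;> simp [exec, Conf.top, Conf.over, take_one_append_tail]
  | raise => cases h <;> cases B <;> simp [exec, Conf.top, Conf.over, take_one_append_tail]
  | take => cases h <;> rcases B with _ | ⟨_ | _, _⟩ <;> simp [exec, Conf.top, Conf.over, take_one_append_tail]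
  | give => cases h <;> rcases A with _ | ⟨_ | _, _⟩ <;> simp [exec, Conf.top, Conf.over, take_one_append_tail]
  | left => cases L <;> cases hm : m.isFree <;> simp [exec, Conf.top, Conf.over, take_one_append_tail, hm]
  | right =>
    rcases R with _ | ⟨_ | _, _⟩ <;> cases hm : m.isFree <;> cases hc : m.isCopy <;>
      simp [exec, Conf.top, Conf.over, take_one_append_tail, hm, hc]
  | letter a => cases m <;> simp [exec, Conf.top, Conf.over, take_one_append_tail]
  | beginCopy => cases m <;> rcases R with _ | ⟨_ | _, _⟩ <;> simp [exec, Conf.top, Conf.over, take_one_append_tail]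
  | endCopy =>
    cases m <;> rcases R with _ | ⟨_ | _, _⟩ <;> simp [exec, Conf.top, Conf.over, take_one_append_tail, AtBoundary]
  | insert =>
    cases m <;> cases h <;> rcases R with _ | ⟨_ | _, _⟩ <;>
      simp [exec, Conf.top, Conf.over, take_one_append_tail, AtBoundary]
  | put => cases m <;> cases N <;> simp [exec, Conf.top, Conf.over, take_one_append_tail]
  | finish => cases m <;> cases N <;> simp [exec, Conf.top, Conf.over, take_one_append_tail]
  | compare => cases m <;> simp [exec, Conf.top, Conf.over, take_one_append_tail]
  | check =>
    cases m <;> cases N <;> cases W <;> simp [exec, Conf.top, Conf.over, take_one_append_tail]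
    split_ifs <;> simp [take_one_append_tail]
  | accept => cases m <;> cases N <;> cases W <;> simp [exec, Conf.top, Conf.over, take_one_append_tail]

theorem step_top_over (c : Conf α) (x : (α ⊕ Bool) ⊕ Cmd α) : (step c.top x).over c = step c x := by
  rcases x with (a | b) | x
  · obtain ⟨m, h, A, B, L, R, N, W⟩ := c
    cases m <;> simp [step, Conf.top, Conf.over, take_one_append_tail]
  · obtain ⟨m, h, A, B, L, R, N, W⟩ := c
    cases m <;> simp [step, Conf.top, Conf.over, take_one_append_tail]
  · have := exec_top_over c x
    obtain ⟨m, h, A, B, L, R, N, W⟩ := c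
    rcases m with _ | ⟨_ | _⟩ | _ | _ | _ | _ | _ | _ | _ | _ | _ <;>
      first
      | exact this
      | simp [step, Conf.top, Conf.over, take_one_append_tail]

/-- No stack has more than `m` symbols. -/
def Conf.Bounded (m : ℕ) (c : Conf α) : Prop :=
  c.A.length ≤ m ∧ c.B.length ≤ m ∧ c.L.length ≤ m ∧ c.R.length ≤ m ∧ c.N.length ≤ m ∧
    c.W.length ≤ m

theorem Conf.Bounded.exec {m : ℕ} {c : Conf α} (h : c.Bounded m) (x : Cmd α) :
    (exec c x).Bounded (m + 1) := by
  obtain ⟨h1, h2, h3, h4, h5, h6⟩ := h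
  cases x <;> simp only [Verifier.exec] <;> (repeat' split) <;>
    (simp_all only [Conf.Bounded, List.length_cons]; omega)

theorem Conf.Bounded.step {m : ℕ} {c : Conf α} (h : c.Bounded m) (x : (α ⊕ Bool) ⊕ Cmd α) :
    (step c x).Bounded (m + 1) := by
  have h' := h
  obtain ⟨h1, h2, h3, h4, h5, h6⟩ := h
  rcases x with (a | b) | x
  · simp only [Verifier.step]
    split <;> simp only [Conf.Bounded, List.length_cons] <;> omega
  · simp only [Verifier.step]
    split <;> simp only [Conf.Bounded, List.length_cons] <;> omega
  · simp only [Verifier.step]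
    split
    · simp only [Conf.Bounded]; omega
    · simp only [Conf.Bounded]; omega
    · simp only [Conf.Bounded]; omega
    · simp only [Conf.Bounded]; omega
    · exact h'.exec x

inductive Stack : Type
  | A | B | L | R | N | W
  deriving DecidableEq

instance : Fintype Stack := ⟨{.A, .B, .L, .R, .N, .W}, fun k => by cases k <;> decide⟩

abbrev Stack.Symbol (α : Type) : Stack → Type
  | A | B => Bool
  | L | R => Option α
  | N | W => α

def Conf.stk (c : Conf α) : ∀ k : Stack, List (k.Symbol α)
  | .A => c.A
  | .B => c.B
  | .L => c.L
  | .R => c.R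
  | .N => c.N
  | .W => c.W

abbrev ofStk (q : Mode × Bool) (s : ∀ k : Stack, List (k.Symbol α)) : Conf α :=
  ⟨q.1, q.2, s .A, s .B, s .L, s .R, s .N, s .W⟩

noncomputable def machine (α : Type) [Fintype α] : StackMachine ((α ⊕ Bool) ⊕ Cmd α) where
  Q := Mode × Bool
  K := Stack
  S := Stack.Symbol α
  finS k := by cases k <;> infer_instance
  start := (.word, false)
  next q x s :=
    (((step (ofStk q s) x).mode, (step (ofStk q s) x).held), (step (ofStk q s) x).stk)
  acc q :=
    match q.1 with
    | .done => true
    | _ => false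
  next_eq q x s := by
    have h := step_top_over (ofStk q s) x
    have h1 := congrArg Conf.mode h
    have h2 := congrArg Conf.held h
    have h3 := congrArg Conf.stk h
    refine Prod.ext (Prod.ext h1.symm h2.symm) (h3.symm.trans ?_)
    funext k
    cases k <;> rfl
  length_next_le q x s hs k := by
    have h := Conf.Bounded.step (c := ofStk q s) (m := 1)
      ⟨hs .A, hs .B, hs .L, hs .R, hs .N, hs .W⟩ x
    obtain ⟨h1, h2, h3, h4, h5, h6⟩ := h
    cases k <;> assumption

theorem runFrom_machine [Fintype α] (c : Conf α) (x : List ((α ⊕ Bool) ⊕ Cmd α)) :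
    (machine α).runFrom ((c.mode, c.held), c.stk) x =
      (((x.foldl step c).mode, (x.foldl step c).held), (x.foldl step c).stk) := by
  induction x generalizing c with
  | nil => rfl
  | cons a x ih => exact ih (step c a)

theorem accepts_machine_iff [Fintype α] (x : List ((α ⊕ Bool) ⊕ Cmd α)) :
    (machine α).accepts x = true ↔ (x.foldl step initial).mode = .done := by
  have h : (machine α).accepts x =
      match (x.foldl step (initial : Conf α)).mode with
      | .done => true
      | _ => false := by
    have := runFrom_machine (initial : Conf α) x
    have e : ((machine α).start, fun _ => []) =
        (((initial : Conf α).mode, (initial : Conf α).held), (initial : Conf α).stk) := by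
      refine Prod.ext rfl ?_
      funext k
      cases k <;> rfl
    exact (congrArg (fun c => (machine α).acc ((machine α).runFrom c x).1) e).trans
      (congrArg (fun c => (machine α).acc c.1) this)
  rw [h]
  cases (x.foldl step (initial : Conf α)).mode <;> simp

/-! #### The counter -/

/-- The number with the given digits, least significant digit first. -/
def num : List Bool → ℕ
  | [] => 0
  | b :: l => b.toNat + 2 * num l

/-- The number with the lower digits `A` (most significant digit first) below `v`. -/
def withLower : List Bool → ℕ → ℕ
  | [], v => v
  | b :: l, v => withLower l (b.toNat + 2 * v)

/-- A unit at any digit position is worth at least `1`; hence spending the held unit pays for a step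
wherever the counter stands. -/
theorem withLower_lt (A : List Bool) {v v' : ℕ} (h : v < v') : withLower A v < withLower A v' := by
  induction A generalizing v v' with
  | nil => exact h
  | cons b A ih => exact ih (by omega)

theorem withLower_le (A : List Bool) {v v' : ℕ} (h : v ≤ v') : withLower A v ≤ withLower A v' := by
  rcases h.lt_or_eq with h | rfl
  · exact (withLower_lt A h).le
  · rfl

theorem withLower_reverse_num (l m : List Bool) :
    withLower l.reverse (num m) = num (l ++ m) := by
  induction l using List.reverseRecOn generalizing m with
  | nil => rfl
  | append_singleton l b ih =>
    rw [List.reverse_append]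
    simpa [withLower, num] using ih (b :: m)

/-- What the counter still allows. -/
def total (held : Bool) (A B : List Bool) : ℕ := withLower A (num B + held.toNat)

theorem num_bits (k : ℕ) : num k.bits = k := by
  induction k using Nat.binaryRec' with
  | zero => simp [num]
  | bit b n h ih =>
    rw [Nat.bits_append_bit _ _ h, num, ih, Nat.bit_val]
    omega

/-- A digit string without leading zeros is determined by its value, so an accepted string is
exactly the encoding of an instance. -/
theorem bits_num (l : List Bool) (h : l.getLast? ≠ some false) : (num l).bits = l := by
  induction l with
  | nil => simp [num]
  | cons b l ih =>
    have e : num (b :: l) = Nat.bit b (num l) := by rw [num, Nat.bit_val]; omega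
    rcases l with _ | ⟨c, l⟩
    · cases b
      · simp at h
      · simp [num]
    · have h' := ih (by simpa using h)
      rw [e, Nat.bits_append_bit, h']
      intro h0
      rw [h0] at h'
      simp at h'

/-! #### Soundness -/

/-- The contents of the tape with the words `vs`. -/
def enc (vs : List (List α)) : List (Option α) := vs.flatMap fun u => none :: u.map some

theorem enc_cons (u : List α) (vs : List (List α)) : enc (u :: vs) = none :: u.map some ++ enc vs :=
  rfl

theorem enc_append (us vs : List (List α)) : enc (us ++ vs) = enc us ++ enc vs := by
  simp [enc]

/-- Letters are written as `some a`, so each `none` on the tape is the marker in front of a word,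
and cutting at it separates whole words. -/
theorem exists_of_append_none_cons_eq_enc {X Y : List (Option α)} {vs : List (List α)}
    (h : X ++ none :: Y = enc vs) :
    ∃ us u ws, vs = us ++ u :: ws ∧ X = enc us ∧ Y = u.map some ++ enc ws := by
  induction vs generalizing X with
  | nil => simp [enc] at h
  | cons v vs ih =>
    rcases X with _ | ⟨x, X⟩
    · rw [enc_cons] at h
      exact ⟨[], v, vs, rfl, rfl, by simpa using h⟩
    · rw [enc_cons, List.cons_append, List.cons_append, List.cons.injEq] at h
      obtain ⟨rfl, h⟩ := h
      rcases List.append_eq_append_iff.1 h with ⟨Z, hZ, hY⟩ | ⟨Z, hZ, hY⟩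
      · have h1 : v.map some = X ++ Z := hZ
        rcases Z with _ | ⟨z, Z⟩
        · obtain ⟨us, u, ws, e1, e2, e3⟩ := ih (X := []) (by simpa using hY)
          refine ⟨v :: us, u, ws, by simp [e1], ?_, e3⟩
          rw [enc_cons, ← e2, h1]; simp
        · rw [List.cons_append, List.cons.injEq] at hY
          have : none ∈ v.map some := by rw [h1, ← hY.1]; simp
          simp at this
      · obtain ⟨us, u, ws, e1, e2, e3⟩ := ih hY.symm
        exact ⟨v :: us, u, ws, by simp [e1], by rw [enc_cons, hZ, e2]; simp, e3⟩

theorem exists_of_append_eq_enc {X Y : List (Option α)} {vs : List (List α)}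
    (h : X ++ Y = enc vs) (hY : AtBoundary Y = true) :
    ∃ us ws, vs = us ++ ws ∧ X = enc us ∧ Y = enc ws := by
  rcases Y with _ | ⟨_ | a, Y⟩
  · exact ⟨vs, [], by simp, by simpa using h, rfl⟩
  · obtain ⟨us, u, ws, e1, e2, e3⟩ := exists_of_append_none_cons_eq_enc h
    exact ⟨us, u :: ws, e1, e2, by rw [e3, enc_cons]; rfl⟩
  · simp [AtBoundary] at hY

theorem eq_nil_of_atBoundary {q : List α} {Y : List (Option α)}
    (h : AtBoundary (q.map some ++ Y) = true) : q = [] := by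
  cases q
  · rfl
  · simp [AtBoundary] at h

/-- The tape holds words from `ws`. -/
def OnTape (ws : List (List α)) (L R : List (Option α)) : Prop :=
  ∃ vs, L.reverse ++ R = enc vs ∧ ∀ u ∈ vs, u ∈ ws

/-- The tape holds words from `ws`, and the head is inside a word, after its prefix `p`. -/
def Inside (ws : List (List α)) (p : List α) (L R : List (Option α)) : Prop :=
  ∃ us q vs, L.reverse = enc us ++ none :: p.map some ∧ R = q.map some ++ enc vs ∧
    ∀ u ∈ us ++ (p ++ q) :: vs, u ∈ ws

/-- What the stacks contain in each mode, if the words `ws` have been assembled. -/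
def Valid (w : List α) (ws : List (List α)) (L R : List (Option α)) (N W : List α) : Mode → Prop
  | .free0 => OnTape ws L R ∧ N = [] ∧ W.reverse = w
  | .free1 => OnTape ws L R ∧ Avail ws N.reverse ∧ W.reverse = w
  | .free2 => OnTape ws L R ∧ (∃ u v, Avail ws u ∧ Avail ws v ∧ N.reverse = u ++ v) ∧ W.reverse = w
  | .copy0 => Inside ws N.reverse L R ∧ W.reverse = w
  | .copy1 => (∃ u p, Avail ws u ∧ N.reverse = u ++ p ∧ Inside ws p L R) ∧ W.reverse = w
  | .ins => (∃ us q vs, L.reverse = enc us ∧ R = q.map some ++ enc vs ∧ N.reverse ++ q ∈ ws ∧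
      ∀ u ∈ us ++ vs, u ∈ ws) ∧ W.reverse = w
  | .cmp => ∃ s, Avail ws (N.reverse ++ s) ∧ W.reverse ++ s = w
  | .done => Avail ws w
  | _ => False

theorem Inside.onTape {ws : List (List α)} {p : List α} {L R : List (Option α)}
    (h : Inside ws p L R) : OnTape ws L R := by
  obtain ⟨us, q, vs, h1, h2, h3⟩ := h
  exact ⟨_, by rw [h1, h2, enc_append, enc_cons]; simp, h3⟩

theorem Inside.mem_of_atBoundary {ws : List (List α)} {p : List α} {L R : List (Option α)}
    (h : Inside ws p L R) (hR : AtBoundary R = true) : p ∈ ws := by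
  obtain ⟨us, q, vs, h1, rfl, h3⟩ := h
  obtain rfl := eq_nil_of_atBoundary hR
  exact h3 p (by simp)

theorem Inside.advance {ws : List (List α)} {p : List α} {L R : List (Option α)} {a : α}
    (h : Inside ws p L (some a :: R)) : Inside ws (p ++ [a]) (some a :: L) R := by
  obtain ⟨us, q, vs, h1, h2, h3⟩ := h
  rcases q with _ | ⟨b, q⟩
  · rcases vs with _ | ⟨v, vs⟩
    · simp [enc] at h2
    · simp [enc_cons] at h2
  · simp only [List.map_cons, List.cons_append, List.cons.injEq, Option.some.injEq] at h2
    obtain ⟨rfl, rfl⟩ := h2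
    exact ⟨us, q, vs, by simp [h1], rfl, by simpa using h3⟩

theorem OnTape.inside {ws : List (List α)} {L R : List (Option α)}
    (h : OnTape ws L (none :: R)) : Inside ws [] (none :: L) R := by
  obtain ⟨vs, h1, h2⟩ := h
  obtain ⟨us, u, ws, rfl, e2, e3⟩ := exists_of_append_none_cons_eq_enc h1
  exact ⟨us, u, ws, by simp [e2], e3, by simpa using h2⟩

theorem OnTape.right {ws : List (List α)} {L R : List (Option α)} {x : Option α}
    (h : OnTape ws L (x :: R)) : OnTape ws (x :: L) R := by
  simpa [OnTape] using h

theorem OnTape.left {ws : List (List α)} {L R : List (Option α)} {x : Option α}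
    (h : OnTape ws (x :: L) R) : OnTape ws L (x :: R) := by
  simpa [OnTape] using h

theorem Valid.move {w : List α} {ws : List (List α)} {L R L' R' : List (Option α)} {N W : List α}
    {m : Mode} (hm : m.isFree = true) (h : OnTape ws L R → OnTape ws L' R')
    (hv : Valid w ws L R N W m) : Valid w ws L' R' N W m := by
  cases m <;> simp only [Mode.isFree, Bool.false_eq_true] at hm <;> exact ⟨h hv.1, hv.2⟩

def Invariant (w : List α) (k : ℕ) (c : Conf α) : Prop :=
  ∃ ws, Assembled ws ∧ ws.length + total c.held c.A c.B ≤ k ∧ Valid w ws c.L c.R c.N c.W c.mode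

/-- The certificate is untrusted, so the invariant must survive every command in every mode. For the
counter only an inequality is needed: commands may waste units but never create them. -/
theorem Invariant.exec {w : List α} {k : ℕ} {c : Conf α} (h : Invariant w k c) (x : Cmd α) :
    Invariant w k (exec c x) := by
  obtain ⟨m, b, A, B, L, R, N, W⟩ := c
  obtain ⟨ws, ha, hk, hv⟩ := h
  simp only at hk hv
  cases x with
  | lower =>
    simp only [Verifier.exec]
    split
    · rename_i d A'
      -- A held unit moved to a lower position loses half its weight, so the total can only shrink.
      refine ⟨ws, ha, (Nat.add_le_add_left ?_ _).trans hk, hv⟩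
      simp only [total, withLower, num]
      exact withLower_le _ (by omega)
    · exact ⟨ws, ha, hk, hv⟩
  | raise =>
    simp only [Verifier.exec]
    split
    · refine ⟨ws, ha, (Nat.add_le_add_left ?_ _).trans hk, hv⟩
      simp [total, withLower, num]
    · exact ⟨ws, ha, hk, hv⟩
  | take =>
    simp only [Verifier.exec]
    split
    · refine ⟨ws, ha, (Nat.add_le_add_left ?_ _).trans hk, hv⟩
      simp only [total, num]
      exact withLower_le _ (by simp)
    · exact ⟨ws, ha, hk, hv⟩
  | give =>
    simp only [Verifier.exec]
    split
    · refine ⟨ws, ha, (Nat.add_le_add_left ?_ _).trans hk, hv⟩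
      simp only [total, withLower, num]
      exact withLower_le _ (by simp; omega)
    · exact ⟨ws, ha, hk, hv⟩
  | left =>
    simp only [Verifier.exec]
    split
    · rename_i hf
      exact ⟨ws, ha, hk, hv.move hf OnTape.left⟩
    · exact ⟨ws, ha, hk, hv⟩
  | right =>
    simp only [Verifier.exec]
    split
    · split_ifs with h1 h2
      · exact ⟨ws, ha, hk, hv.move h1 OnTape.right⟩
      · refine ⟨ws, ha, hk, ?_⟩
        cases m <;> simp only [Mode.isCopy, Bool.false_eq_true] at h2
        · exact ⟨by simpa using hv.1.advance, hv.2⟩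
        · obtain ⟨⟨u, p, h3, h4, h5⟩, h6⟩ := hv
          exact ⟨⟨u, _, h3, by simp [h4], h5.advance⟩, h6⟩
      · exact ⟨ws, ha, hk, hv⟩
    · split_ifs with h1
      · exact ⟨ws, ha, hk, hv.move h1 OnTape.right⟩
      · exact ⟨ws, ha, hk, hv⟩
    · exact ⟨ws, ha, hk, hv⟩
  | letter a =>
    simp only [Verifier.exec]
    split
    · obtain ⟨h1, rfl, h2⟩ := hv
      exact ⟨ws, ha, hk, h1, .inr ⟨a, rfl⟩, h2⟩
    · obtain ⟨h1, h2, h3⟩ := hv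
      exact ⟨ws, ha, hk, h1, ⟨_, [a], h2, .inr ⟨a, rfl⟩, by simp⟩, h3⟩
    · exact ⟨ws, ha, hk, hv⟩
  | beginCopy =>
    simp only [Verifier.exec]
    split
    · obtain ⟨h1, rfl, h2⟩ := hv
      exact ⟨ws, ha, hk, h1.inside, h2⟩
    · obtain ⟨h1, h2, h3⟩ := hv
      exact ⟨ws, ha, hk, ⟨_, [], h2, by simp, h1.inside⟩, h3⟩
    · exact ⟨ws, ha, hk, hv⟩
  | endCopy =>
    simp only [Verifier.exec]
    split
    · rename_i hb
      exact ⟨ws, ha, hk, hv.1.onTape, .inl (hv.1.mem_of_atBoundary hb), hv.2⟩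
    · rename_i hb
      obtain ⟨⟨u, p, h3, h4, h5⟩, h6⟩ := hv
      exact ⟨ws, ha, hk, h5.onTape, ⟨u, p, h3, .inl (h5.mem_of_atBoundary hb), h4⟩, h6⟩
    · exact ⟨ws, ha, hk, hv⟩
  | insert =>
    simp only [Verifier.exec]
    split
    · rename_i hb
      obtain ⟨⟨vs, h1, h2⟩, ⟨u, v, hu, hv, h3⟩, h4⟩ := hv
      obtain ⟨us, vs', rfl, e1, e2⟩ := exists_of_append_eq_enc h1 hb
      -- The new word counts as assembled from here on, before it is written; the unit given up
      -- compensates for the longer list.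
      refine ⟨_, ha.cons hu hv, ?_, ⟨us, [], vs', e1, by simpa using e2, by simp [h3], ?_⟩, h4⟩
      · have : total false A B < total true A B := withLower_lt _ (by simp)
        simp only [List.length_cons]
        omega
      · exact fun x hx => List.mem_cons_of_mem _ (h2 x hx)
    · exact ⟨ws, ha, hk, hv⟩
  | put =>
    simp only [Verifier.exec]
    split
    · rename_i a N'
      obtain ⟨⟨us, q, vs, h1, rfl, h2, h3⟩, h4⟩ := hv
      exact ⟨ws, ha, hk, ⟨us, a :: q, vs, h1, rfl, by simpa using h2, h3⟩, h4⟩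
    · exact ⟨ws, ha, hk, hv⟩
  | finish =>
    simp only [Verifier.exec]
    split
    · obtain ⟨⟨us, q, vs, h1, rfl, h2, h3⟩, h4⟩ := hv
      refine ⟨ws, ha, hk, ⟨us ++ q :: vs, ?_, ?_⟩, rfl, h4⟩
      · rw [enc_append, enc_cons, h1]; rfl
      · intro x hx
        simp only [List.mem_append, List.mem_cons] at hx h3
        rcases hx with hx | rfl | hx
        · exact h3 x (.inl hx)
        · simpa using h2
        · exact h3 x (.inr hx)
    · exact ⟨ws, ha, hk, hv⟩
  | compare =>
    simp only [Verifier.exec]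
    split
    · obtain ⟨h1, h2, h3⟩ := hv
      exact ⟨ws, ha, hk, [], by simpa using h2, by simpa using h3⟩
    · exact ⟨ws, ha, hk, hv⟩
  | check =>
    simp only [Verifier.exec]
    split
    · split_ifs with h
      · subst h
        obtain ⟨s, h1, h2⟩ := hv
        exact ⟨ws, ha, hk, _ :: s, by simpa using h1, by simpa using h2⟩
      · exact ⟨ws, ha, hk, hv⟩
    · exact ⟨ws, ha, hk, hv⟩
  | accept =>
    simp only [Verifier.exec]
    split
    · obtain ⟨s, h1, h2⟩ := hv
      refine ⟨ws, ha, hk, ?_⟩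
      simp only [List.reverse_nil, List.nil_append] at h1 h2
      exact h2 ▸ h1
    · exact ⟨ws, ha, hk, hv⟩

/-- The configuration after reading the letters of `w` and the digits `bs`. -/
def afterReading (w : List α) (bs : List Bool) : Conf α :=
  ⟨match bs.getLast? with
    | none => .word
    | some b => .num b, false, bs.reverse, [], [], [], [], w.reverse⟩

/-! ### Reading the instance -/

theorem foldl_step_instance (w : List α) (bs : List Bool) :
    (w.map Sum.inl ++ bs.map Sum.inr).foldl (fun c a => step c (.inl a)) initial =
      afterReading w bs := by
  induction bs using List.reverseRecOn with
  | nil =>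
    induction w using List.reverseRecOn with
    | nil => rfl
    | append_singleton w a ih =>
      simp only [List.map_nil, List.append_nil] at ih ⊢
      rw [List.map_append, List.foldl_append, ih]
      simp [step, afterReading]
  | append_singleton bs b ih =>
    rw [List.map_append, ← List.append_assoc, List.foldl_append, ih]
    rcases hb : bs.getLast? with _ | d <;> simp [step, afterReading, hb]

theorem foldl_step_cases (x : List (α ⊕ Bool)) :
    (∃ (w : List α) (bs : List Bool), x = w.map Sum.inl ++ bs.map Sum.inr) ∨
      (x.foldl (fun c a => step c (.inl a)) initial).mode = .dead := by
  induction x using List.reverseRecOn with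
  | nil => exact .inl ⟨[], [], rfl⟩
  | append_singleton x a ih =>
    rw [List.foldl_append]
    rcases ih with ⟨w, bs, rfl⟩ | h
    · rcases a with a | b
      · rcases bs.eq_nil_or_concat with rfl | ⟨bs, b, rfl⟩
        · exact .inl ⟨w ++ [a], [], by simp⟩
        · right
          rw [foldl_step_instance]
          simp [step, afterReading]
      · exact .inl ⟨w, bs ++ [b], by simp⟩
    · right
      generalize x.foldl (fun c a => step c (.inl a)) (initial : Conf α) = c at h
      rcases a with a | b <;> simp [step, h]

theorem foldl_step_of_stuck (c : Conf α) (hc : c.mode = .dead ∨ c.mode = .num false)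
    (y : List (Cmd α)) : y.foldl (fun c a => step c (.inr a)) c = c := by
  induction y with
  | nil => rfl
  | cons a y ih =>
    rw [List.foldl_cons]
    convert ih
    rcases hc with hc | hc <;> simp [step, hc]

theorem Invariant.foldl {w : List α} {k : ℕ} {c : Conf α} (h : Invariant w k c)
    (y : List (Cmd α)) : Invariant w k (y.foldl (fun c a => step c (.inr a)) c) := by
  induction y generalizing c with
  | nil => exact h
  | cons a y ih =>
    refine ih ?_
    have h' := h.exec a
    obtain ⟨m, b, A, B, L, R, N, W⟩ := c
    obtain ⟨ws, -, -, hv⟩ := h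
    -- `Valid` is false in the reading modes and in `dead`; in all other modes `step` is `exec`.
    cases m <;> first | exact hv.elim | exact h'

theorem sound {x : List (α ⊕ Bool)} {y : List (Cmd α)}
    (h : (y.foldl (fun c a => step c (.inr a))
      (x.foldl (fun c a => step c (.inl a)) initial)).mode = .done) :
    x ∈ asiDecLanguage α := by
  rcases foldl_step_cases x with ⟨w, bs, rfl⟩ | hd
  swap
  · rw [foldl_step_of_stuck _ (.inl hd), hd] at h
    simp at h
  rw [foldl_step_instance] at h
  rcases eq_or_ne bs.getLast? (some false) with hf | hf
  · rw [foldl_step_of_stuck _ (.inr (by simp [afterReading, hf]))] at h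
    simp [afterReading, hf] at h
  have hinv : Invariant w (num bs) { afterReading w bs with mode := .free0 } := by
    refine ⟨[], .nil, ?_, ⟨[], rfl, by simp⟩, rfl, by simp [afterReading]⟩
    have := withLower_reverse_num bs []
    simp only [num, List.append_nil] at this
    simp [total, afterReading, num, this]
  rcases y with _ | ⟨a, y⟩
  · simp only [List.foldl_nil, afterReading] at h
    rcases hb : bs.getLast? with _ | b <;> simp [hb] at h
  · rw [List.foldl_cons] at h
    have hs : step (afterReading w bs) (.inr a) = { afterReading w bs with mode := .free0 } := by
      rcases hb : bs.getLast? with _ | _ | _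
      · simp [step, afterReading, hb]
      · exact absurd hb hf
      · simp [step, afterReading, hb]
    rw [hs] at h
    obtain ⟨ws, ha, hk, hv⟩ := hinv.foldl y
    rw [h] at hv
    refine ⟨w, num bs, ⟨ha.ne_nil hv, asi_le_iff.2 ⟨ws, ha, by omega, hv⟩⟩, ?_⟩
    rw [encodeInstance, bits_num bs hf]

/-! #### Completeness -/

/-- Some certificate of length at most `m` leads from `c` to `d`. -/
def Reach (m : ℕ) (c d : Conf α) : Prop :=
  ∃ y : List (Cmd α), y.length ≤ m ∧ y.foldl (fun c a => step c (.inr a)) c = d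

theorem Reach.refl (c : Conf α) : Reach 0 c c := ⟨[], le_rfl, rfl⟩

theorem Reach.trans {m n : ℕ} {c d e : Conf α} (h : Reach m c d) (h' : Reach n d e) :
    Reach (m + n) c e := by
  obtain ⟨y, hy, rfl⟩ := h
  obtain ⟨z, hz, rfl⟩ := h'
  exact ⟨y ++ z, by simp; omega, by simp⟩

theorem Reach.mono {m n : ℕ} {c d : Conf α} (h : Reach m c d) (hmn : m ≤ n) : Reach n c d :=
  let ⟨y, hy, e⟩ := h
  ⟨y, hy.trans hmn, e⟩

theorem Reach.single {c d : Conf α} (x : Cmd α) (h : step c (.inr x) = d) : Reach 1 c d :=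
  ⟨[x], le_rfl, h⟩

/-- Reading leaves the most significant digit on top of `A`; pouring all digits into `B` puts the
least significant one on top, where decrementing starts. -/
theorem reach_lower (h : Bool) (A B : List Bool) (L R : List (Option α)) (N W : List α) :
    Reach A.length ⟨.free0, h, A, B, L, R, N, W⟩ ⟨.free0, h, [], A.reverse ++ B, L, R, N, W⟩ := by
  induction A generalizing B with
  | nil => exact .refl _
  | cons a A ih =>
    have h1 : Reach 1 (⟨.free0, h, a :: A, B, L, R, N, W⟩ : Conf α)
        ⟨.free0, h, A, a :: B, L, R, N, W⟩ := .single .lower rfl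
    have h2 := h1.trans (ih (a :: B))
    rw [Nat.add_comm] at h2
    simpa using h2

/-- This is binary borrowing: climb past the zeros with `raise`, `take` a unit from the lowest `1`,
and on the way down let `give` turn each zero into a one. Each digit costs at most two commands. -/
theorem reach_decrement (A B : List Bool) (L R : List (Option α)) (N W : List α)
    (hB : 1 ≤ num B) :
    ∃ B', num B' + 1 = num B ∧ B'.length = B.length ∧
      Reach (2 * B.length) ⟨.free0, false, A, B, L, R, N, W⟩ ⟨.free0, true, A, B', L, R, N, W⟩ := by
  induction B generalizing A with
  | nil => simp [num] at hB
  | cons b B ih =>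
    cases b
    · have hB' : 1 ≤ num B := by simp [num] at hB; omega
      obtain ⟨B', h1, h2, h3⟩ := ih (false :: A) hB'
      refine ⟨true :: B', by simp [num]; omega, by simp [h2], ?_⟩
      have h4 : Reach 1 (⟨.free0, false, A, false :: B, L, R, N, W⟩ : Conf α)
          ⟨.free0, false, false :: A, B, L, R, N, W⟩ := .single .raise rfl
      have h5 : Reach 1 (⟨.free0, true, false :: A, B', L, R, N, W⟩ : Conf α)
          ⟨.free0, true, A, true :: B', L, R, N, W⟩ := .single .give rfl
      refine ((h4.trans h3).trans h5).mono ?_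
      simp; omega
    · exact ⟨false :: B, by simp [num]; omega, by simp,
        (Reach.single .take rfl).mono (by simp; omega)⟩

theorem reach_right {m : Mode} (hm : m.isFree = true) (h : Bool) (A B : List Bool)
    (X L R : List (Option α)) (N W : List α) :
    Reach X.length ⟨m, h, A, B, L, X ++ R, N, W⟩ ⟨m, h, A, B, X.reverse ++ L, R, N, W⟩ := by
  induction X generalizing L with
  | nil => exact .refl _
  | cons x X ih =>
    have h1 : Reach 1 (⟨m, h, A, B, L, x :: (X ++ R), N, W⟩ : Conf α)
        ⟨m, h, A, B, x :: L, X ++ R, N, W⟩ := by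
      refine .single .right ?_
      cases m <;> simp only [Mode.isFree, Bool.false_eq_true] at hm <;> cases x <;> rfl
    have h2 := h1.trans (ih (x :: L))
    rw [Nat.add_comm] at h2
    simpa using h2

theorem reach_left {m : Mode} (hm : m.isFree = true) (h : Bool) (A B : List Bool)
    (L R : List (Option α)) (N W : List α) :
    Reach L.length ⟨m, h, A, B, L, R, N, W⟩ ⟨m, h, A, B, [], L.reverse ++ R, N, W⟩ := by
  induction L generalizing R with
  | nil => exact .refl _
  | cons x L ih =>
    have h1 : Reach 1 (⟨m, h, A, B, x :: L, R, N, W⟩ : Conf α)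
        ⟨m, h, A, B, L, x :: R, N, W⟩ := by
      refine .single .left ?_
      cases m <;> simp only [Mode.isFree, Bool.false_eq_true] at hm <;> rfl
    have h2 := h1.trans (ih (x :: R))
    rw [Nat.add_comm] at h2
    simpa using h2

theorem reach_copy {m : Mode} (hm : m.isCopy = true) (h : Bool) (A B : List Bool)
    (u : List α) (L R : List (Option α)) (N W : List α) :
    Reach u.length ⟨m, h, A, B, L, u.map some ++ R, N, W⟩
      ⟨m, h, A, B, (u.map some).reverse ++ L, R, u.reverse ++ N, W⟩ := by
  induction u generalizing L N with
  | nil => exact .refl _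
  | cons x u ih =>
    have h1 : Reach 1 (⟨m, h, A, B, L, some x :: (u.map some ++ R), N, W⟩ : Conf α)
        ⟨m, h, A, B, some x :: L, u.map some ++ R, x :: N, W⟩ := by
      refine .single .right ?_
      cases m <;> simp only [Mode.isCopy, Bool.false_eq_true] at hm <;> rfl
    have h2 := h1.trans (ih (some x :: L) (x :: N))
    rw [Nat.add_comm] at h2
    simpa using h2

theorem atBoundary_enc (ws : List (List α)) : AtBoundary (enc ws) = true := by
  cases ws <;> rfl

/-- The head runs to the word, copies it and returns, hence twice the tape length plus two commands
for entering and leaving copy mode. It serves for both parts of a new word and for fetching `w` at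
the end. -/
theorem reach_part {m m' : Mode} (hm : m = .free0 ∧ m' = .free1 ∨ m = .free1 ∧ m' = .free2)
    {ws : List (List α)} {u : List α} (hu : Avail ws u) (h : Bool) (A B : List Bool)
    (N W : List α) :
    Reach (2 * (enc ws).length + 2) ⟨m, h, A, B, [], enc ws, N, W⟩
      ⟨m', h, A, B, [], enc ws, u.reverse ++ N, W⟩ := by
  rcases hu with hu | ⟨a, rfl⟩
  · obtain ⟨us, vs, rfl⟩ := List.append_of_mem hu
    have hf : m.isFree = true ∧ m'.isFree = true := by
      rcases hm with ⟨rfl, rfl⟩ | ⟨rfl, rfl⟩ <;> exact ⟨rfl, rfl⟩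
    obtain ⟨c, hc, h1, h2⟩ : ∃ c : Mode, c.isCopy = true ∧
        (∀ L R N, Reach 1 (⟨m, h, A, B, L, none :: R, N, W⟩ : Conf α)
          ⟨c, h, A, B, none :: L, R, N, W⟩) ∧
        ∀ L N, Reach 1 (⟨c, h, A, B, L, enc vs, N, W⟩ : Conf α)
          ⟨m', h, A, B, L, enc vs, N, W⟩ := by
      rcases hm with ⟨rfl, rfl⟩ | ⟨rfl, rfl⟩
      · refine ⟨.copy0, rfl, fun L R N => .single .beginCopy rfl, fun L N => .single .endCopy ?_⟩
        simp [step, exec, atBoundary_enc]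
      · refine ⟨.copy1, rfl, fun L R N => .single .beginCopy rfl, fun L N => .single .endCopy ?_⟩
        simp [step, exec, atBoundary_enc]
    have h3 := reach_right hf.1 h A B (enc us) [] (none :: (u.map some ++ enc vs)) N W
    have h4 := h1 ((enc us).reverse ++ []) (u.map some ++ enc vs) N
    have h5 := reach_copy hc h A B u (none :: ((enc us).reverse ++ [])) (enc vs) N W
    have h6 := h2 ((u.map some).reverse ++ none :: ((enc us).reverse ++ [])) (u.reverse ++ N)
    have h7 := reach_left hf.2 h A B ((u.map some).reverse ++ none :: ((enc us).reverse ++ []))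
      (enc vs) (u.reverse ++ N) W
    have h8 := (((h3.trans h4).trans h5).trans h6).trans h7
    rw [enc_append, enc_cons]
    refine Reach.mono (by simpa using h8) ?_
    simp; omega
  · refine (Reach.single (.letter a) ?_).mono (by omega : 1 ≤ _)
    rcases hm with ⟨rfl, rfl⟩ | ⟨rfl, rfl⟩ <;> rfl

theorem reach_put (A B : List Bool) (L R : List (Option α)) (N W : List α) :
    Reach N.length ⟨.ins, false, A, B, L, R, N, W⟩
      ⟨.ins, false, A, B, L, N.reverse.map some ++ R, [], W⟩ := by
  induction N generalizing R with
  | nil => exact .refl _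
  | cons x N ih =>
    have h1 : Reach 1 (⟨.ins, false, A, B, L, R, x :: N, W⟩ : Conf α)
        ⟨.ins, false, A, B, L, some x :: R, N, W⟩ := .single .put rfl
    have h2 := h1.trans (ih (some x :: R))
    rw [Nat.add_comm] at h2
    simpa using h2

theorem reach_cons {ws : List (List α)} {u v : List α} (hu : Avail ws u) (hv : Avail ws v)
    (B : List Bool) (hB : 1 ≤ num B) (W : List α) :
    ∃ B', num B' + 1 = num B ∧ B'.length = B.length ∧
      Reach (2 * B.length + 4 * (enc ws).length + (u ++ v).length + 6)
        ⟨.free0, false, [], B, [], enc ws, [], W⟩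
        ⟨.free0, false, [], B', [], enc ((u ++ v) :: ws), [], W⟩ := by
  obtain ⟨B', h1, h2, h3⟩ := reach_decrement [] B [] (enc ws) [] W hB
  refine ⟨B', h1, h2, ?_⟩
  have h4 := reach_part (.inl ⟨rfl, rfl⟩) hu true [] B' [] W
  have h5 := reach_part (.inr ⟨rfl, rfl⟩) hv true [] B' (u.reverse ++ []) W
  have h6 : Reach 1
      (⟨.free2, true, [], B', [], enc ws, v.reverse ++ (u.reverse ++ []), W⟩ : Conf α)
      ⟨.ins, false, [], B', [], enc ws, v.reverse ++ (u.reverse ++ []), W⟩ :=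
    .single .insert (by simp [step, exec, atBoundary_enc])
  have h7 := reach_put [] B' [] (enc ws) (v.reverse ++ (u.reverse ++ [])) W
  have h8 : Reach 1
      (⟨.ins, false, [], B', [], (v.reverse ++ (u.reverse ++ [])).reverse.map some ++ enc ws,
        [], W⟩ : Conf α)
      ⟨.free0, false, [], B', [], enc ((u ++ v) :: ws), [], W⟩ :=
    .single .finish (by simp [step, exec, enc_cons])
  refine (((((h3.trans h4).trans h5).trans h6).trans h7).trans h8).mono ?_
  simp
  omega

theorem length_enc_le {ws : List (List α)} {n : ℕ} (h : ∀ u ∈ ws, u.length ≤ n) :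
    (enc ws).length ≤ ws.length * (n + 1) := by
  induction ws with
  | nil => simp [enc]
  | cons u ws ih =>
    have h1 := ih fun x hx => h x (List.mem_cons_of_mem _ hx)
    have h2 := h u (by simp)
    rw [enc_cons]
    simp only [List.length_append, List.length_cons, List.length_map, Nat.add_mul]
    omega

/-- The bounds `m` and `n` stay fixed during the induction, so that all steps have the same cost
estimate; both are later taken to be the length of `w`. -/
theorem reach_assembled {ws : List (List α)} (ha : Assembled ws) {n m : ℕ}
    (hm : ws.length ≤ m) (hn : ∀ u ∈ ws, u.length ≤ n) (B : List Bool) (hB : ws.length ≤ num B)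
    (W : List α) :
    ∃ B', num B' + ws.length = num B ∧ B'.length = B.length ∧
      Reach (ws.length * (2 * B.length + 4 * (m * (n + 1)) + n + 6))
        ⟨.free0, false, [], B, [], [], [], W⟩ ⟨.free0, false, [], B', [], enc ws, [], W⟩ := by
  induction ha with
  | nil => exact ⟨B, by simp, rfl, (Reach.refl _).mono (by simp)⟩
  | @cons ws u v _ hu hv ih =>
    simp only [List.length_cons] at hm hB
    have hn' : ∀ x ∈ ws, x.length ≤ n := fun x hx => hn x (List.mem_cons_of_mem _ hx)
    obtain ⟨B', h1, h2, h3⟩ := ih (by omega) hn' (by omega)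
    obtain ⟨B'', h4, h5, h6⟩ := reach_cons hu hv B' (by omega) W
    refine ⟨B'', by simp; omega, by omega, (h3.trans h6).mono ?_⟩
    have h7 : (enc ws).length ≤ m * (n + 1) :=
      (length_enc_le hn').trans (Nat.mul_le_mul_right _ (by omega))
    have h8 := hn (u ++ v) (by simp)
    rw [List.length_cons, Nat.add_mul, Nat.one_mul, h2]
    omega

theorem reach_check (B : List Bool) (R : List (Option α)) (W : List α) :
    Reach W.length ⟨.cmp, false, [], B, [], R, W, W⟩ ⟨.cmp, false, [], B, [], R, [], []⟩ := by
  induction W with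
  | nil => exact .refl _
  | cons x W ih =>
    have h1 : Reach 1 (⟨.cmp, false, [], B, [], R, x :: W, x :: W⟩ : Conf α)
        ⟨.cmp, false, [], B, [], R, W, W⟩ := .single .check (by simp [step, exec])
    have h2 := h1.trans ih
    rw [Nat.add_comm] at h2
    simpa using h2

/-- The bound on the length of certificates. -/
noncomputable def bound : Polynomial ℕ :=
  open Polynomial in
  -- The summands pay for leaving the reading mode, pouring the counter, the assembly steps,
  -- fetching `w`, and the final comparison.
  1 + X + X * (2 * X + 4 * (X * (X + 1)) + X + 6) + (2 * (X * (X + 1)) + 2) + (X + 2)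

theorem complete {x : List (α ⊕ Bool)} (hx : x ∈ asiDecLanguage α) :
    ∃ y : List (Cmd α), y.length ≤ bound.eval x.length ∧
      (y.foldl (fun c a => step c (.inr a))
        (x.foldl (fun c a => step c (.inl a)) initial)).mode = .done := by
  obtain ⟨w, k, ⟨hw, hk⟩, rfl⟩ := hx
  obtain ⟨ws, ha, h1, h2, h3, h4⟩ := exists_assembled_of_asi_le hw hk
  simp only at hw hk h1 h2 h3 h4
  have hbits : k.bits.getLast? ≠ some false := by
    intro h
    have key : ∀ k : ℕ, k.bits.getLast? ≠ some false := fun k => by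
      induction k using Nat.binaryRec' with
      | zero => simp
      | bit b n h ih =>
        rw [Nat.bits_append_bit _ _ h, List.getLast?_cons]
        rcases hn : n.bits.getLast? with _ | c
        · rcases Nat.eq_zero_or_pos n with rfl | hpos
          · simp [h rfl]
          · have : n.bits = [] := by simpa using hn
            have := num_bits n
            simp_all [num]
        · simpa [hn] using ih
    exact key k h
  have hread : Reach 1 (afterReading w k.bits)
      ⟨.free0, false, k.bits.reverse, [], [], [], [], w.reverse⟩ := by
    -- Any command would do: the first one only ends the reading phase.
    refine .single .accept ?_
    rcases hb : k.bits.getLast? with _ | _ | _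
    · simp [step, afterReading, hb]
    · exact absurd hb hbits
    · simp [step, afterReading, hb]
  have hlow := reach_lower false k.bits.reverse [] [] [] [] w.reverse
  have hnum : num (k.bits.reverse.reverse ++ []) = k := by simp [num_bits]
  obtain ⟨B, -, -, hasm⟩ := reach_assembled ha h2 h3 (k.bits.reverse.reverse ++ [])
    (by omega) w.reverse
  have hpart := reach_part (.inl ⟨rfl, rfl⟩) h4 false [] B [] w.reverse
  have hcmp : Reach 1
      (⟨.free1, false, [], B, [], enc ws, w.reverse ++ [], w.reverse⟩ : Conf α)
      ⟨.cmp, false, [], B, [], enc ws, w.reverse, w.reverse⟩ :=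
    .single .compare (by simp [step, exec])
  have hcheck := reach_check B (enc ws) w.reverse
  have hacc : Reach 1 (⟨.cmp, false, [], B, [], enc ws, [], []⟩ : Conf α)
      ⟨.done, false, [], B, [], enc ws, [], []⟩ := .single .accept rfl
  obtain ⟨y, hy, e⟩ :=
    (((((hread.trans hlow).trans hasm).trans hpart).trans hcmp).trans hcheck).trans hacc
  refine ⟨y, hy.trans ?_, ?_⟩
  · clear hy e
    simp only [bound, encodeInstance, Polynomial.eval_add, Polynomial.eval_mul, Polynomial.eval_X,
      Polynomial.eval_one, Polynomial.eval_ofNat, List.length_append, List.length_map,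
      List.length_reverse, List.append_nil]
    have hE := length_enc_le h3
    generalize hX : w.length + k.bits.length = X
    have hE' : (enc ws).length ≤ X * (X + 1) :=
      hE.trans (Nat.mul_le_mul (by omega) (by omega))
    have hmul : ws.length * (2 * k.bits.length + 4 * (w.length * (w.length + 1)) + w.length + 6) ≤
        X * (2 * X + 4 * (X * (X + 1)) + X + 6) := by
      have : w.length * (w.length + 1) ≤ X * (X + 1) := Nat.mul_le_mul (by omega) (by omega)
      exact Nat.mul_le_mul (by omega) (by omega)
    omega
  · rw [encodeInstance, foldl_step_instance, e]

end Verifier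

open Verifier in
/-- The problem is in NP. -/
theorem inNP_asiDecLanguage (α : Type) [Fintype α] : InNP (asiDecLanguage α) := by
  refine ⟨Cmd α, inferInstance, bound, _, ⟨(machine α).computableInPolyTime _⟩, fun x => ?_⟩
  have key : ∀ y : List (Cmd α),
      (machine α).accepts (x.map Sum.inl ++ y.map Sum.inr) = true ↔
        (y.foldl (fun c a => step c (.inr a))
          (x.foldl (fun c a => step c (.inl a)) initial)).mode = .done := fun y => by
    rw [accepts_machine_iff, List.foldl_append, List.foldl_map, List.foldl_map]
  simp only [key]
  exact ⟨complete, fun ⟨y, _, hy⟩ => sound hy⟩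

end Assembly

namespace RAM

open Function

/-! ### Reasoning about random access machines -/

def Bdd (W : ℕ) (r m : ℕ → ℕ) : Prop := (∀ i, r i ≤ W) ∧ ∀ i, m i ≤ W

theorem Bdd.update_reg {W : ℕ} {r m : ℕ → ℕ} (h : Bdd W r m) {d v : ℕ} (hv : v ≤ W) :
    Bdd W (update r d v) m := by
  refine ⟨fun i => ?_, h.2⟩
  rw [update_apply]
  split_ifs
  · exact hv
  · exact h.1 i

theorem Bdd.update_mem {W : ℕ} {r m : ℕ → ℕ} (h : Bdd W r m) {d v : ℕ} (hv : v ≤ W) :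
    Bdd W r (update m d v) := by
  refine ⟨h.1, fun i => ?_⟩
  rw [update_apply]
  split_ifs
  · exact hv
  · exact h.2 i

/-- From the configuration the machine stops within `T` steps with the answer whether `φ` holds, and
no number exceeds `W` on the way. -/
inductive Halts (P : Program) (W : ℕ) (φ : Prop) : ℕ → Cfg → Prop
  | halt {T : ℕ} {c : Cfg} {ans : Bool} : Bdd W c.reg c.mem → P[c.pc]? = some (.halt ans) →
      (ans = true ↔ φ) → Halts P W φ T c
  | step {T : ℕ} {c c' : Cfg} : Bdd W c.reg c.mem → RAM.step P c = some c' → Halts P W φ T c' →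
      Halts P W φ (T + 1) c

theorem iterate_bind_none {β : Type} (f : β → Option β) (m : ℕ) :
    (fun o : Option β => o.bind f)^[m] none = none := by
  induction m with
  | zero => rfl
  | succ m ih => rw [iterate_succ_apply]; exact ih

theorem Halts.mono {P : Program} {W T T' : ℕ} {φ : Prop} {c : Cfg} (hT : T ≤ T')
    (h : Halts P W φ T c) : Halts P W φ T' c := by
  induction h generalizing T' with
  | halt hB hP hφ => exact .halt hB hP hφ
  | step hB hs _ ih =>
    obtain ⟨T', rfl⟩ := Nat.exists_eq_add_of_le' hT
    exact .step hB hs (ih (by omega : _ ≤ T' + _))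

theorem Halts.spec {P : Program} {W T : ℕ} {φ : Prop} {c : Cfg} (h : Halts P W φ T c) :
    (∃ m ≤ T, ∃ c' : Cfg, ∃ ans : Bool, (fun o => o.bind (RAM.step P))^[m] (some c) = some c' ∧
      P[c'.pc]? = some (.halt ans) ∧ (ans = true ↔ φ)) ∧
    ∀ m c', (fun o => o.bind (RAM.step P))^[m] (some c) = some c' → Bdd W c'.reg c'.mem := by
  induction h with
  | @halt T c ans hB hP hφ =>
    refine ⟨⟨0, Nat.zero_le _, c, ans, rfl, hP, hφ⟩, fun m c' h => ?_⟩
    rcases m with _ | m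
    · obtain rfl := Option.some.inj h
      exact hB
    · have hs : RAM.step P c = none := by simp [RAM.step, hP]
      rw [iterate_succ_apply, Option.bind_some, hs, iterate_bind_none] at h
      simp at h
  | @step T c c' hB hs _ ih =>
    obtain ⟨⟨m, hm, d, ans, h1, h2, h3⟩, h4⟩ := ih
    refine ⟨⟨m + 1, by omega, d, ans, ?_, h2, h3⟩, fun m e h => ?_⟩
    · rw [iterate_succ_apply, Option.bind_some, hs, h1]
    · rcases m with _ | m
      · obtain rfl := Option.some.inj h
        exact hB
      · rw [iterate_succ_apply, Option.bind_some, hs] at h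
        exact h4 m e h

section

variable {P : Program} {W T : ℕ} {φ : Prop} {pc d a b l v : ℕ} {r m : ℕ → ℕ}

/-- These rules execute a program symbolically, one instruction at a time. The word bound for the
new state is handed to the continuation, and where an argument `v` names the new value, expressions
in the registers stay small. -/
theorem Halts.const (hB : Bdd W r m) (hi : P[pc]? = some (.const d v)) (hv : v ≤ W)
    (h : Bdd W (update r d v) m → Halts P W φ T ⟨pc + 1, update r d v, m⟩) :
    Halts P W φ (T + 1) ⟨pc, r, m⟩ :=
  .step hB (by simp [RAM.step, hi]) (h (hB.update_reg hv))

theorem Halts.move (v : ℕ) (hB : Bdd W r m) (hi : P[pc]? = some (.move d a)) (hv : r a = v)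
    (h : Bdd W (update r d v) m → Halts P W φ T ⟨pc + 1, update r d v, m⟩) :
    Halts P W φ (T + 1) ⟨pc, r, m⟩ :=
  .step hB (by simp [RAM.step, hi, hv]) (h (hB.update_reg (hv ▸ hB.1 a)))

theorem Halts.add (v : ℕ) (hB : Bdd W r m) (hi : P[pc]? = some (.add d a b)) (hv : r a + r b = v)
    (hW : v ≤ W) (h : Bdd W (update r d v) m → Halts P W φ T ⟨pc + 1, update r d v, m⟩) :
    Halts P W φ (T + 1) ⟨pc, r, m⟩ :=
  .step hB (by simp [RAM.step, hi, hv]) (h (hB.update_reg hW))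

theorem Halts.sub (v : ℕ) (hB : Bdd W r m) (hi : P[pc]? = some (.sub d a b)) (hv : r a - r b = v)
    (h : Bdd W (update r d v) m → Halts P W φ T ⟨pc + 1, update r d v, m⟩) :
    Halts P W φ (T + 1) ⟨pc, r, m⟩ :=
  .step hB (by simp [RAM.step, hi, hv])
    (h (hB.update_reg (hv ▸ (Nat.sub_le _ _).trans (hB.1 a))))

theorem Halts.load (x v : ℕ) (hB : Bdd W r m) (hi : P[pc]? = some (.load d a)) (hx : r a = x)
    (hv : m x = v) (h : Bdd W (update r d v) m → Halts P W φ T ⟨pc + 1, update r d v, m⟩) :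
    Halts P W φ (T + 1) ⟨pc, r, m⟩ :=
  .step hB (by simp [RAM.step, hi, hx, hv]) (h (hB.update_reg (hv ▸ hB.2 x)))

theorem Halts.store (x v : ℕ) (hB : Bdd W r m) (hi : P[pc]? = some (.store a b)) (hx : r a = x)
    (hv : r b = v) (h : Bdd W r (update m x v) → Halts P W φ T ⟨pc + 1, r, update m x v⟩) :
    Halts P W φ (T + 1) ⟨pc, r, m⟩ :=
  .step hB (by simp [RAM.step, hi, hx, hv]) (h (hB.update_mem (hv ▸ hB.1 b)))

theorem Halts.jump (hB : Bdd W r m) (hi : P[pc]? = some (.jump l))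
    (h : Halts P W φ T ⟨l, r, m⟩) : Halts P W φ (T + 1) ⟨pc, r, m⟩ :=
  .step hB (by simp [RAM.step, hi]) h

theorem Halts.jumpLT_of_lt (hB : Bdd W r m) (hi : P[pc]? = some (.jumpLT a b l)) (hlt : r a < r b)
    (h : Halts P W φ T ⟨l, r, m⟩) : Halts P W φ (T + 1) ⟨pc, r, m⟩ :=
  .step hB (by simp [RAM.step, hi, hlt]) h

theorem Halts.jumpLT_of_le (hB : Bdd W r m) (hi : P[pc]? = some (.jumpLT a b l)) (hle : r b ≤ r a)
    (h : Halts P W φ T ⟨pc + 1, r, m⟩) : Halts P W φ (T + 1) ⟨pc, r, m⟩ :=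
  .step hB (by simp [RAM.step, hi, hle.not_gt]) h

theorem Halts.jumpEQ_of_eq (hB : Bdd W r m) (hi : P[pc]? = some (.jumpEQ a b l)) (he : r a = r b)
    (h : Halts P W φ T ⟨l, r, m⟩) : Halts P W φ (T + 1) ⟨pc, r, m⟩ :=
  .step hB (by simp [RAM.step, hi, he]) h

theorem Halts.jumpEQ_of_ne (hB : Bdd W r m) (hi : P[pc]? = some (.jumpEQ a b l)) (hne : r a ≠ r b)
    (h : Halts P W φ T ⟨pc + 1, r, m⟩) : Halts P W φ (T + 1) ⟨pc, r, m⟩ :=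
  .step hB (by simp [RAM.step, hi, hne]) h

end

end RAM

namespace Assembly

open Function

variable {α : Type}

/-! ### The values of a plan -/

theorem Ptr.resolve_of_prefix {xs ys : List (List α)} (h : xs <+: ys) {p : Ptr α} {u : List α}
    (hu : p.resolve xs = some u) : p.resolve ys = some u := by
  obtain ⟨zs, rfl⟩ := h
  cases p with
  | letter a => exact hu
  | step j =>
    have hj : xs[j]? = some u := hu
    have := (List.getElem?_eq_some_iff.1 hj).1
    simpa [Ptr.resolve, List.getElem?_append_left this] using hj

/-- Letters occupy the codes below `s`, so legality of a pointer is a single comparison. -/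
theorem Ptr.exists_resolve_iff {s : ℕ} (e : α ≃ Fin s) (xs : List (List α)) (p : Ptr α) :
    (∃ u, p.resolve xs = some u) ↔ p.code e < s + xs.length := by
  cases p with
  | letter a =>
    have := (e a).2
    simp only [Ptr.resolve, Ptr.code]
    exact ⟨fun _ => by omega, fun _ => ⟨_, rfl⟩⟩
  | step j => simp [Ptr.resolve, Ptr.code, List.getElem?_eq_some_iff]

theorem Plan.prefix_of_evalFrom {ys xs : List (List α)} {p : Plan α}
    (h : Plan.evalFrom ys p = some xs) : ys <+: xs := by
  induction p generalizing ys with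
  | nil => obtain rfl := Option.some.inj h; exact List.prefix_rfl
  | cons x p ih =>
    obtain ⟨a, b⟩ := x
    rw [Plan.evalFrom] at h
    split at h
    · exact (List.prefix_append _ _).trans (ih h)
    · simp at h

/-- Later steps only append results, so pointers may be resolved in the final list. This lets the
machine expand a legal plan without regard to when a step was made. -/
theorem Plan.exists_of_evalFrom {ys xs : List (List α)} {p : Plan α}
    (h : Plan.evalFrom ys p = some xs) {i : ℕ} {a b : Ptr α} (hi : p[i]? = some (a, b)) :
    ∃ u v, a.resolve xs = some u ∧ b.resolve xs = some v ∧
      xs[ys.length + i]? = some (u ++ v) := by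
  induction p generalizing ys i with
  | nil => simp at hi
  | cons x p ih =>
    obtain ⟨a', b'⟩ := x
    rw [Plan.evalFrom] at h
    split at h
    · rename_i u v hu hv
      have hp := Plan.prefix_of_evalFrom h
      rcases i with _ | i
      · obtain ⟨rfl, rfl⟩ : a' = a ∧ b' = b := by simpa using hi
        have hp' := (List.prefix_append ys [u ++ v]).trans hp
        refine ⟨u, v, Ptr.resolve_of_prefix hp' hu, Ptr.resolve_of_prefix hp' hv, ?_⟩
        obtain ⟨zs, rfl⟩ := hp
        simp
      · obtain ⟨u', v', h1, h2, h3⟩ := ih h (by simpa using hi)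
        refine ⟨u', v', h1, h2, ?_⟩
        rw [← h3]
        congr 1
        simp; omega
    · simp at h

theorem Plan.evalFrom_take_succ {p : Plan α} {i : ℕ} {a b : Ptr α} (hi : p[i]? = some (a, b))
    {xs : List (List α)} (hx : Plan.evalFrom [] (p.take i) = some xs) {u v : List α}
    (hu : a.resolve xs = some u) (hv : b.resolve xs = some v) :
    Plan.evalFrom [] (p.take (i + 1)) = some (xs ++ [u ++ v]) := by
  rw [List.take_add_one, hi, Plan.evalFrom_append, hx]
  simp [Plan.evalFrom, hu, hv]

theorem Plan.evalFrom_eq_none {p : Plan α} {i : ℕ} {a b : Ptr α} (hi : p[i]? = some (a, b))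
    {xs : List (List α)} (hx : Plan.evalFrom [] (p.take i) = some xs)
    (h : ¬ (∃ u, a.resolve xs = some u) ∨ ¬ ∃ u, b.resolve xs = some u) :
    Plan.evalFrom [] p = none := by
  obtain ⟨hlt, he⟩ := List.getElem?_eq_some_iff.1 hi
  rw [← List.take_append_drop i p, Plan.evalFrom_append, hx, Option.bind_some,
    List.drop_eq_getElem_cons hlt, he, Plan.evalFrom]
  split
  · rename_i hu hv
    exact (h.elim (fun h => h ⟨_, hu⟩) fun h => h ⟨_, hv⟩).elim
  · rfl

theorem Plan.length_of_evalFrom {p : Plan α} {xs : List (List α)}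
    (h : Plan.evalFrom [] p = some xs) : xs.length = p.length := by
  simpa using (Assembled.nil.of_evalFrom (p := p) h).2

theorem Plan.ne_nil_of_resolve {p : Plan α} {xs : List (List α)}
    (h : Plan.evalFrom [] p = some xs) {a : Ptr α} {u : List α} (hu : a.resolve xs = some u) :
    u ≠ [] :=
  (Assembled.nil.of_evalFrom (p := p) h).1.ne_nil (Ptr.avail_of_resolve (by simpa using hu))

/-! ### The input of the verifier -/

section Input

variable {s : ℕ} (e : α ≃ Fin s) (w : List α) (k : ℕ) (p : Plan α)

theorem Plan.length_codes : (Plan.codes e p).length = 2 * p.length := by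
  induction p with
  | nil => rfl
  | cons x p ih =>
    have : Plan.codes e (x :: p) = [x.1.code e, x.2.code e] ++ Plan.codes e p := rfl
    simp [this, ih]; omega

theorem Plan.getD_codes {i : ℕ} {a b : Ptr α} (hi : p[i]? = some (a, b)) :
    (Plan.codes e p).getD (2 * i) 0 = a.code e ∧ (Plan.codes e p).getD (2 * i + 1) 0 = b.code e := by
  induction p generalizing i with
  | nil => simp at hi
  | cons x p ih =>
    have hc : Plan.codes e (x :: p) = x.1.code e :: x.2.code e :: Plan.codes e p := rfl
    rcases i with _ | i
    · obtain rfl : x = (a, b) := by simpa using hi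
      simp [hc]
    · simpa [hc, Nat.mul_add] using ih (by simpa using hi)

theorem getD_verifierInput_word {i : ℕ} (hi : i < w.length) :
    (verifierInput e w k p).getD (3 + i) 0 = e w[i] := by
  rw [verifierInput, List.append_assoc, List.getD_append_right _ _ _ _ (by simp),
    List.getD_append _ _ _ _ (by simpa using hi)]
  simp [hi]

theorem getD_verifierInput_plan (i : ℕ) :
    (verifierInput e w k p).getD (3 + w.length + i) 0 = (Plan.codes e p).getD i 0 := by
  rw [verifierInput, List.getD_append_right _ _ _ _ (by simp; omega)]
  congr 1
  simp; omega

end Input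

end Assembly

/-! ### The random access verifier and its expansion loop -/

namespace Assembly

open Function

open RAM in
/-- The verifier for an alphabet of `s` letters. It checks the pointers, and then expands the last
step with a stack of pointers, comparing letters with `w`.
Registers: `0` holds `1`, `1` the size of the alphabet, `5` and `10` the end of `w` and the current
position in `w`, `6` and `11` the bottom and the top of the stack, `7` the address of the pointer
being checked, `8` the bound for its value, and `14` the largest legal value of the sum of `10` and
`11`. -/
def verifierProgram (s : ℕ) : RAM.Program :=
  [.const 0 1, .const 1 s, .load 2 12, .load 3 0, .add 13 0 0, .load 4 13,
   .jumpLT 3 4 17, .jumpEQ 4 12 17, .const 10 3, .add 5 10 2, .move 7 5, .add 6 5 4, .add 6 6 4,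
   .move 8 1,
   -- 14: checking the pointers
   .jumpEQ 7 6 25, .load 9 7, .jumpLT 9 8 18, .halt false,
   .add 7 7 0, .load 9 7, .jumpLT 9 8 22, .halt false, .add 7 7 0, .add 8 8 0, .jump 14,
   -- 25: initializing the stack
   .sub 9 8 0, .store 6 9, .add 11 6 0, .add 14 6 5,
   -- 29: the next pointer
   .jumpEQ 11 6 51, .sub 11 11 0, .load 9 11, .jumpLT 9 1 46,
   -- 33: a pointer to a step
   .sub 9 9 1, .add 9 9 9, .add 9 9 5, .add 13 9 0, .load 13 13, .load 9 9, .store 11 13,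
   .add 11 11 0, .store 11 9, .add 11 11 0, .add 13 11 10, .jumpLT 14 13 17, .jump 29,
   -- 46: a pointer to a letter
   .load 13 10, .jumpEQ 13 9 49, .halt false, .add 10 10 0, .jump 29,
   -- 51: the end
   .jumpEQ 10 5 53, .halt false, .halt true]

section

variable {α : Type} {s : ℕ} (e : α ≃ Fin s) (w : List α) (k : ℕ) (p : Plan α)

/-- The memory from address `base` on holds the stack `st` (the top first). -/
def HoldsStack (m : ℕ → ℕ) (base : ℕ) : List (Ptr α) → Prop
  | [] => True
  | a :: st => m (base + st.length) = a.code e ∧ HoldsStack m base st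

variable {e} in
theorem HoldsStack.update {m : ℕ → ℕ} {base : ℕ} {st : List (Ptr α)} (h : HoldsStack e m base st)
    {x v : ℕ} (hx : base + st.length ≤ x) : HoldsStack e (update m x v) base st := by
  induction st with
  | nil => trivial
  | cons a st ih =>
    rw [List.length_cons] at hx
    exact ⟨by rw [update_of_ne (by omega)]; exact h.1, ih h.2 (by omega)⟩

/-- The memory below the stack holds the input. -/
def HoldsInput (m : ℕ → ℕ) : Prop :=
  ∀ i < 3 + w.length + 2 * p.length, m i = (verifierInput e w k p).getD i 0

variable {e w k p}

theorem HoldsInput.update {m : ℕ → ℕ} (h : HoldsInput e w k p m) {x v : ℕ}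
    (hx : 3 + w.length + 2 * p.length ≤ x) : HoldsInput e w k p (update m x v) := by
  intro i hi
  rw [update_of_ne (by omega)]
  exact h i hi

theorem HoldsInput.word {m : ℕ → ℕ} (h : HoldsInput e w k p m) {i : ℕ} (hi : i < w.length) :
    m (3 + i) = e w[i] := by
  rw [h _ (by omega), getD_verifierInput_word e w k p hi]

theorem HoldsInput.plan {m : ℕ → ℕ} (h : HoldsInput e w k p m) {i : ℕ} {a b : Ptr α}
    (hi : p[i]? = some (a, b)) :
    m (3 + w.length + 2 * i) = a.code e ∧ m (3 + w.length + 2 * i + 1) = b.code e := by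
  have := (List.getElem?_eq_some_iff.1 hi).1
  rw [h _ (by omega), h _ (by omega), Nat.add_assoc _ (2 * i), getD_verifierInput_plan,
    getD_verifierInput_plan]
  exact Plan.getD_codes e p hi

/-- The concatenation of the words that the pointers refer to. -/
def expand (xs : List (List α)) (st : List (Ptr α)) : List α :=
  st.flatMap fun a => (a.resolve xs).getD []

theorem expand_cons {xs : List (List α)} {a : Ptr α} {u : List α} (h : a.resolve xs = some u)
    (st : List (Ptr α)) : expand xs (a :: st) = u ++ expand xs st := by
  simp [expand, h]

theorem length_le_length_expand {xs : List (List α)} (hp : Plan.evalFrom [] p = some xs)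
    {st : List (Ptr α)} (hst : ∀ a ∈ st, ∃ u, a.resolve xs = some u) :
    st.length ≤ (expand xs st).length := by
  induction st with
  | nil => simp
  | cons a st ih =>
    obtain ⟨u, hu⟩ := hst a (by simp)
    have h1 := ih fun b hb => hst b (List.mem_cons_of_mem _ hb)
    have h2 := List.length_pos_of_ne_nil (Plan.ne_nil_of_resolve hp hu)
    rw [expand_cons hu, List.length_append, List.length_cons]
    omega

/-- The fuel `d` bounds how far `2 * pos + st.length` is below `2 * w.length`. Matching a letter
changes the two terms by `+2` and `-1`, replacing a step pointer by its two parts changes the height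
by `+1`, so each round uses one unit of fuel. The longest round, the one for a step pointer, has
`17` instructions. -/
theorem halts_expand {W : ℕ} (hW : 10 + 2 * w.length + 2 * p.length + s ≤ W)
    {xs : List (List α)} (hp : Plan.evalFrom [] p = some xs) {φ : Prop} (d : ℕ) (r m : ℕ → ℕ)
    (pos : ℕ) (st : List (Ptr α)) (hd : 2 * w.length ≤ d + 2 * pos + st.length)
    (hB : RAM.Bdd W r m) (h0 : r 0 = 1) (h1 : r 1 = s) (h5 : r 5 = 3 + w.length)
    (h6 : r 6 = 3 + w.length + 2 * p.length) (h10 : r 10 = 3 + pos)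
    (h11 : r 11 = 3 + w.length + 2 * p.length + st.length)
    (h14 : r 14 = 6 + 2 * w.length + 2 * p.length) (hm : HoldsInput e w k p m)
    (hs : HoldsStack e m (3 + w.length + 2 * p.length) st) (hpos : pos + st.length ≤ w.length)
    (hst : ∀ a ∈ st, ∃ u, a.resolve xs = some u) (hφ : φ ↔ expand xs st = w.drop pos) :
    RAM.Halts (verifierProgram s) W φ (17 * d + 3) ⟨29, r, m⟩ := by
  induction d generalizing r m pos st with
  | zero =>
    -- Without fuel, `hd` and `hpos` leave only the empty stack at the end of `w`.
    obtain rfl : st = [] := List.length_eq_zero_iff.1 (by omega)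
    obtain rfl : pos = w.length := by simp at hpos hd; omega
    refine .jumpEQ_of_eq (l := 51) hB rfl (by simp [h6, h11]) ?_
    refine .jumpEQ_of_eq (l := 53) hB rfl (by simp [h5, h10]) ?_
    exact .halt hB rfl (by simp [hφ, expand])
  | succ d ih =>
    rw [show 17 * (d + 1) + 3 = 17 * d + 3 + 17 by omega]
    rcases st with _ | ⟨a, st⟩
    · refine .jumpEQ_of_eq (l := 51) hB rfl (by simp [h6, h11]) ?_
      by_cases hw : pos = w.length
      · refine .jumpEQ_of_eq (l := 53) hB rfl (by simp [h5, h10, hw]) ?_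
        exact .halt hB rfl (by simp [hφ, expand, hw])
      · refine .jumpEQ_of_ne hB rfl (by simp [h5, h10, hw]) ?_
        refine .halt hB rfl ?_
        simp only [List.length_nil] at hpos
        have : w.drop pos ≠ [] := by simp; omega
        simp [hφ, expand, this.symm]
    · simp only [List.length_cons] at hd h11 hpos
      obtain ⟨hs1, hs2⟩ := hs
      obtain ⟨x, hx⟩ := hst a (by simp)
      have hst' : ∀ b ∈ st, ∃ u, b.resolve xs = some u := fun b hb =>
        hst b (List.mem_cons_of_mem _ hb)
      rw [expand_cons hx] at hφ
      refine .jumpEQ_of_ne hB rfl (by rw [h6, h11]; omega) ?_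
      refine .sub (3 + w.length + 2 * p.length + st.length) hB rfl (by omega) fun hB => ?_
      refine .load _ _ hB rfl (by simp) hs1 fun hB => ?_
      rcases a with a | j
      · obtain rfl : [a] = x := Option.some.inj hx
        have hlt : pos < w.length := by omega
        rw [List.drop_eq_getElem_cons hlt, List.singleton_append, List.cons.injEq] at hφ
        refine .jumpLT_of_lt (l := 46) hB rfl (by simp [h1, Ptr.code]) ?_
        refine .load _ _ hB rfl (by simp [h10]) (hm.word hlt) fun hB => ?_
        by_cases ha : a = w[pos]
        · refine .jumpEQ_of_eq (l := 49) hB rfl (by simp [Ptr.code, ha]) ?_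
          refine .add (3 + (pos + 1)) hB rfl ?_ (by omega) fun hB => ?_
          · simp [h10, h0]; omega
          refine .jump (l := 29) hB rfl ?_
          refine RAM.Halts.mono ?_ (ih _ m (pos + 1) st (by omega) hB ?_ ?_ ?_ ?_ ?_ ?_ ?_ hm hs2
            (by omega) hst' (by simp [hφ, ha]))
          · omega
          all_goals simp [*]
        · refine .jumpEQ_of_ne hB rfl ?_ ?_
          · simpa [Ptr.code, Fin.val_inj] using fun h => ha h.symm
          · exact .halt hB rfl (by simp [hφ, ha])
      · have hj : xs[j]? = some x := hx
        have hjt : j < p.length := by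
          rw [← Plan.length_of_evalFrom hp]; exact (List.getElem?_eq_some_iff.1 hj).1
        obtain ⟨⟨a, b⟩, hab⟩ : ∃ ab, p[j]? = some ab := ⟨_, List.getElem?_eq_getElem hjt⟩
        obtain ⟨u, v, hu, hv, hxj⟩ := Plan.exists_of_evalFrom hp hab
        obtain rfl : x = u ++ v := by simpa [hj] using hxj
        obtain ⟨hma, hmb⟩ := hm.plan hab
        have hφ' : φ ↔ expand xs (a :: b :: st) = w.drop pos := by
          rw [hφ, expand_cons hu, expand_cons hv, List.append_assoc]
        have hst'' : ∀ c ∈ a :: b :: st, ∃ u, c.resolve xs = some u := by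
          simp only [List.mem_cons]
          rintro c (rfl | rfl | hc)
          · exact ⟨u, hu⟩
          · exact ⟨v, hv⟩
          · exact hst' c hc
        refine .jumpLT_of_le hB rfl (by simp [h1, Ptr.code]) ?_
        refine .sub j hB rfl (by simp [h1, Ptr.code]) fun hB => ?_
        refine .add (2 * j) hB rfl (by simp; omega) (by omega) fun hB => ?_
        refine .add (3 + w.length + 2 * j) hB rfl ?_ (by omega) fun hB => ?_
        · simp [h5]; omega
        refine .add (3 + w.length + 2 * j + 1) hB rfl ?_ (by omega) fun hB => ?_
        · simp [h0]
        refine .load _ _ hB rfl (by simp) hmb fun hB => ?_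
        refine .load _ _ hB rfl (by simp) hma fun hB => ?_
        -- The second part goes below the first and overwrites the cell just popped, so that the
        -- first part is expanded next.
        refine .store (3 + w.length + 2 * p.length + st.length) (b.code e) hB rfl
          (by simp) (by simp) fun hB => ?_
        refine .add (3 + w.length + 2 * p.length + st.length + 1) hB rfl
          (by simp [h0]) (by omega) fun hB => ?_
        refine .store (3 + w.length + 2 * p.length + st.length + 1) (a.code e) hB rfl
          (by simp) (by simp) fun hB => ?_
        refine .add (3 + w.length + 2 * p.length + (st.length + 2)) hB rfl
          (by simp [h0]; omega) (by omega) fun hB => ?_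
        refine .add (3 + w.length + 2 * p.length + (st.length + 2) + (3 + pos)) hB rfl
          (by simp [h10]) (by omega) fun hB => ?_
        -- This is the test of registers `10` and `11` against `14`. If it fails, the nonempty words
        -- on the stack need more letters than `w` has left, and rejecting is correct.
        by_cases hle : pos + (st.length + 2) ≤ w.length
        · refine .jumpLT_of_le hB rfl (by simp [h14]; omega) ?_
          refine .jump (l := 29) hB rfl ?_
          refine RAM.Halts.mono ?_ (ih _ _ pos (a :: b :: st) (by simp; omega) hB ?_ ?_ ?_ ?_ ?_
            ?_ ?_ ((hm.update (by omega)).update (by omega)) ⟨?_, ?_, ?_⟩ (by simpa using hle)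
            hst'' hφ')
          · omega
          any_goals simp [update_apply, *]
          · omega
          · exact (hs2.update le_rfl).update (by omega)
        · refine .jumpLT_of_lt (l := 17) hB rfl (by simp [h14]; omega) ?_
          refine .halt hB rfl ?_
          simp only [Bool.false_eq_true, false_iff, hφ']
          intro h
          have h1 := length_le_length_expand hp hst''
          rw [h] at h1
          simp at h1
          omega

end

end Assembly

/-! ### The complete run of the verifier, and the size of plans -/

namespace Assembly

open Function

variable {α : Type} {s : ℕ} {e : α ≃ Fin s} {w : List α} {k : ℕ} {p : Plan α}

theorem halts_start_expand {W : ℕ} (hW : 10 + 2 * w.length + 2 * p.length + s ≤ W)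
    {xs : List (List α)} (hp : Plan.evalFrom [] p = some xs) {φ : Prop} (r m : ℕ → ℕ)
    (hB : RAM.Bdd W r m) (h0 : r 0 = 1) (h1 : r 1 = s) (h5 : r 5 = 3 + w.length)
    (h6 : r 6 = 3 + w.length + 2 * p.length) (h8 : r 8 = s + p.length) (h10 : r 10 = 3)
    (hm : HoldsInput e w k p m) (ht : 1 ≤ p.length) (hw : 1 ≤ w.length) (hφ : φ ↔ p.Builds w) :
    RAM.Halts (verifierProgram s) W φ (34 * w.length + 7) ⟨25, r, m⟩ := by
  have hlen := Plan.length_of_evalFrom hp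
  obtain ⟨x, hx⟩ : ∃ x, xs[p.length - 1]? = some x :=
    ⟨_, List.getElem?_eq_getElem (by omega)⟩
  have hst : ∀ a ∈ [Ptr.step (p.length - 1)], ∃ u, a.resolve xs = some u := by
    simpa using ⟨x, hx⟩
  have hφ' : φ ↔ expand xs [Ptr.step (p.length - 1)] = w.drop 0 := by
    rw [hφ, expand_cons (show (Ptr.step _).resolve xs = some x from hx), Plan.Builds, hp]
    simp [List.getLast?_eq_getElem?, hlen, hx, expand]
  refine .sub (s + (p.length - 1)) hB rfl (by rw [h8, h0]; omega) fun hB => ?_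
  refine .store _ _ hB rfl (by simp [h6]; rfl) (by simp; rfl) fun hB => ?_
  refine .add (3 + w.length + 2 * p.length + 1) hB rfl (by simp [h6, h0]) (by omega) fun hB => ?_
  refine .add (6 + 2 * w.length + 2 * p.length) hB rfl (by simp [h5, h6]; omega)
    (by omega) fun hB => ?_
  refine RAM.Halts.mono (le_of_eq ?_) (halts_expand hW hp (2 * w.length) _ _ 0
    [Ptr.step (p.length - 1)] (by simp) hB ?_ ?_ ?_ ?_ ?_ ?_ ?_ (hm.update le_rfl) ⟨?_, trivial⟩
    (by simpa using hw) hst hφ')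
  · omega
  all_goals simp [*, Ptr.code]

/-- The loop maintains that the first `i` steps evaluate. Since no words are formed here, only
pointer codes compared, a step takes constant time; one illegal pointer spoils the whole plan, so
immediate rejection is correct. -/
theorem halts_check {W : ℕ} (hW : 10 + 2 * w.length + 2 * p.length + s ≤ W) {φ : Prop} (d : ℕ)
    (r m : ℕ → ℕ) (i : ℕ) (hd : i + d = p.length)
    (hB : RAM.Bdd W r m) (h0 : r 0 = 1) (h1 : r 1 = s) (h5 : r 5 = 3 + w.length)
    (h6 : r 6 = 3 + w.length + 2 * p.length) (h7 : r 7 = 3 + w.length + 2 * i) (h8 : r 8 = s + i)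
    (h10 : r 10 = 3) (hm : HoldsInput e w k p m) (ht : 1 ≤ p.length) (hw : 1 ≤ w.length)
    (hi : ∃ xs, Plan.evalFrom [] (p.take i) = some xs) (hφ : φ ↔ p.Builds w) :
    RAM.Halts (verifierProgram s) W φ (34 * w.length + 8 + 11 * d) ⟨14, r, m⟩ := by
  induction d generalizing r i with
  | zero =>
    obtain rfl : i = p.length := by omega
    obtain ⟨xs, hxs⟩ := hi
    rw [List.take_length] at hxs
    exact .jumpEQ_of_eq (l := 25) hB rfl (by rw [h6, h7])
      (halts_start_expand hW hxs r m hB h0 h1 h5 h6 h8 h10 hm ht hw hφ)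
  | succ d ih =>
    rw [show 34 * w.length + 8 + 11 * (d + 1) = 34 * w.length + 8 + 11 * d + 11 by omega]
    obtain ⟨xs, hxs⟩ := hi
    obtain ⟨⟨a, b⟩, hab⟩ : ∃ ab, p[i]? = some ab := ⟨_, List.getElem?_eq_getElem (by omega)⟩
    obtain ⟨hma, hmb⟩ := hm.plan hab
    have hlen : xs.length = i := by
      rw [Plan.length_of_evalFrom hxs, List.length_take]; omega
    have ha := Ptr.exists_resolve_iff e xs a
    have hb := Ptr.exists_resolve_iff e xs b
    rw [hlen] at ha hb
    have hreject (h : ¬ (∃ u, a.resolve xs = some u) ∨ ¬ ∃ u, b.resolve xs = some u) : ¬ φ := by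
      rw [hφ, Plan.Builds, Plan.evalFrom_eq_none hab hxs h]
      simp
    refine .jumpEQ_of_ne hB rfl (by rw [h6, h7]; omega) ?_
    refine .load _ _ hB rfl h7 hma fun hB => ?_
    by_cases hca : a.code e < s + i
    swap
    · refine .jumpLT_of_le hB rfl (by simpa [h8] using hca) ?_
      exact .halt hB rfl (by simpa using hreject (.inl (ha.not.2 hca)))
    refine .jumpLT_of_lt (l := 18) hB rfl (by simpa [h8] using hca) ?_
    refine .add (3 + w.length + 2 * i + 1) hB rfl (by simp [h0, h7]) (by omega) fun hB => ?_
    refine .load _ _ hB rfl (by simp) hmb fun hB => ?_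
    by_cases hcb : b.code e < s + i
    swap
    · refine .jumpLT_of_le hB rfl (by simpa [h8] using hcb) ?_
      exact .halt hB rfl (by simpa using hreject (.inr (hb.not.2 hcb)))
    refine .jumpLT_of_lt (l := 22) hB rfl (by simpa [h8] using hcb) ?_
    obtain ⟨u, hu⟩ := ha.2 hca
    obtain ⟨v, hv⟩ := hb.2 hcb
    refine .add (3 + w.length + 2 * (i + 1)) hB rfl (by simp [h0]; omega) (by omega)
      fun hB => ?_
    refine .add (s + (i + 1)) hB rfl (by simp [h0, h8]; omega) (by omega)
      fun hB => ?_
    refine .jump (l := 14) hB rfl ?_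
    refine RAM.Halts.mono ?_ (ih _ (i + 1) (by omega) hB ?_ ?_ ?_ ?_ ?_ ?_ ?_
      ⟨_, Plan.evalFrom_take_succ hab hxs hu hv⟩)
    · omega
    all_goals simp [*]

/-- Too long plans are rejected before anything is computed from their length, and illegal pointers
are only loaded and compared. Hence numbers beyond the linear bound can come only from the input
itself. -/
theorem halts_verifier (hk : k + 2 ≤ w.length) {M W : ℕ}
    (hM : ∀ x ∈ verifierInput e w k p, x ≤ M) (hMW : M ≤ W)
    (hW : 10 + 4 * w.length + s ≤ W) :
    RAM.Halts (verifierProgram s) W (p.length ≤ k ∧ p.Builds w) (45 * w.length + 22)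
      (RAM.init (verifierInput e w k p)) := by
  have hB : RAM.Bdd W (fun _ => 0) fun i => (verifierInput e w k p).getD i 0 := by
    refine ⟨fun _ => Nat.zero_le _, fun i => ?_⟩
    simp only [List.getD_eq_getElem?_getD]
    rcases h : (verifierInput e w k p)[i]? with _ | x
    · exact Nat.zero_le _
    · exact (hM x (List.mem_of_getElem? h)).trans hMW
  rw [RAM.init]
  refine .const hB rfl (by omega) fun hB => ?_
  refine .const hB rfl (by omega) fun hB => ?_
  refine .load 0 w.length hB rfl rfl rfl fun hB => ?_
  refine .load 1 k hB rfl rfl rfl fun hB => ?_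
  refine .add 2 hB rfl rfl (by omega) fun hB => ?_
  refine .load 2 p.length hB rfl rfl rfl fun hB => ?_
  by_cases hpk : p.length ≤ k
  swap
  · refine .jumpLT_of_lt (l := 17) hB rfl (by simpa [update_apply] using hpk) ?_
    exact .halt hB rfl (by simp [hpk])
  refine .jumpLT_of_le hB rfl (by simpa [update_apply] using hpk) ?_
  -- An empty plan has no last word and builds nothing.
  rcases Nat.eq_zero_or_pos p.length with hp0 | hp0
  · refine .jumpEQ_of_eq (l := 17) hB rfl (by simpa [update_apply] using hp0) ?_
    refine .halt hB rfl ?_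
    obtain rfl := List.length_eq_zero_iff.1 hp0
    simp [Plan.Builds, Plan.evalFrom]
  refine .jumpEQ_of_ne hB rfl (by simp; rintro rfl; simp at hp0) ?_
  refine .const hB rfl (by omega) fun hB => ?_
  refine .add (3 + w.length) hB rfl rfl (by omega) fun hB => ?_
  refine .move (3 + w.length) hB rfl rfl fun hB => ?_
  refine .add (3 + w.length + p.length) hB rfl rfl (by omega) fun hB => ?_
  refine .add (3 + w.length + 2 * p.length) hB rfl (by simp; omega) (by omega)
    fun hB => ?_
  refine .move s hB rfl rfl fun hB => ?_
  refine RAM.Halts.mono ?_ (halts_check (W := W) (e := e) (w := w) (k := k) (p := p) (by omega)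
    p.length _ _ 0 (by omega) hB rfl rfl rfl rfl rfl rfl rfl (fun _ _ => rfl) hp0 (by omega)
    ⟨[], rfl⟩ (and_iff_right hpk))
  omega

theorem length_bits_le (e : α ≃ Fin s) (hk : k + 2 ≤ w.length) (hp : p.length ≤ k) :
    (Plan.bits e p).length ≤ (2 * s + 100) * w.length * Nat.log 2 w.length := by
  have h1 : (Plan.bits e p).length = 2 * p.length * Nat.size (s + p.length) := by
    rw [Plan.bits, List.length_flatMap]
    simp [Plan.length_codes]
  -- The word has at least two letters, so additive constants can be absorbed into the logarithm.
  have h2 : 1 ≤ Nat.log 2 w.length := Nat.log_pos (by omega) (by omega)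
  have h3 : Nat.size (s + p.length) ≤ s + (Nat.log 2 w.length + 1) := by
    rw [Nat.size_le, pow_add]
    have h4 : s + 1 ≤ 2 ^ s := Nat.lt_two_pow_self
    have h5 : w.length < 2 ^ (Nat.log 2 w.length + 1) := Nat.lt_pow_succ_log_self (by omega) _
    calc s + p.length < (s + 1) * w.length := by nlinarith
      _ ≤ _ := Nat.mul_le_mul h4 h5.le
  rw [h1]
  have h6 : s + (Nat.log 2 w.length + 1) ≤ (s + 2) * Nat.log 2 w.length := by nlinarith
  calc 2 * p.length * Nat.size (s + p.length)
      ≤ 2 * w.length * ((s + 2) * Nat.log 2 w.length) :=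
        Nat.mul_le_mul (by omega) (h3.trans h6)
    _ = (2 * s + 4) * w.length * Nat.log 2 w.length := by ring
    _ ≤ _ := Nat.mul_le_mul_right _ (Nat.mul_le_mul_right _ (by omega))

end Assembly

open Assembly in
theorem mainTheorem4 (α : Type) [Fintype α] :
    -- the problem is in NP
    InNP (asiDecLanguage α) ∧
    -- if `k ≥ n - 1`, the instance is a yes-instance
    (∀ (w : List α) (k : ℕ), w ≠ [] → w.length ≤ k + 1 → (w, k) ∈ ASIDec α) ∧
    -- otherwise, the witnesses are the plans of at most `k` steps given by pointers
    (∀ (w : List α) (k : ℕ), k + 2 ≤ w.length →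
      ((w, k) ∈ ASIDec α ↔ ∃ p : Plan α, p.length ≤ k ∧ p.Builds w)) ∧
    -- they have `O(n log n)` bits, and are checked in time `O(n ^ 2)`
    ∃ (P : RAM.Program) (C : ℕ), ∀ (e : α ≃ Fin (Fintype.card α)) (w : List α) (k : ℕ),
      k + 2 ≤ w.length → ∀ p : Plan α,
        (p.length ≤ k → (p.bits e).length ≤ C * w.length * Nat.log 2 w.length) ∧
        RAM.DecidesWithin P (verifierInput e w k p) (p.length ≤ k ∧ p.Builds w)
          (C * w.length ^ 2) ∧
        ∀ M : ℕ, (∀ x ∈ verifierInput e w k p, x ≤ M) →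
          RAM.WordsBoundedBy P (verifierInput e w k p) (max M (C * w.length ^ 2)) := by
  refine ⟨inNP_asiDecLanguage α, fun _ _ => mem_asiDec_of_length_le,
    fun _ _ => mem_asiDec_iff_exists_plan, verifierProgram (Fintype.card α),
    -- One constant has to dominate the factor `2 * s + 4` of the encoding, the time `45 * n + 22`
    -- and the word size `10 + 4 * n + s`.
    2 * Fintype.card α + 100, fun e w k hk p => ⟨length_bits_le e hk, ?_⟩⟩
  generalize Fintype.card α = s at e ⊢
  have hn : 2 ≤ w.length := by omega
  have hn2 : w.length ≤ w.length ^ 2 := Nat.le_self_pow (by omega) _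
  have hC : 10 + 4 * w.length + s ≤ (2 * s + 100) * w.length ^ 2 := by nlinarith
  have hT : 45 * w.length + 22 ≤ (2 * s + 100) * w.length ^ 2 := by nlinarith
  constructor
  -- The time bound involves no word bound, so any bound on the input serves, for instance its sum.
  · have hM : ∀ x ∈ verifierInput e w k p, x ≤ (verifierInput e w k p).sum :=
      fun x hx => List.le_sum_of_mem hx
    exact ((halts_verifier hk hM (le_max_left _ _) (hC.trans (le_max_right _ _))).mono hT).spec.1
  · intro M hM
    exact (halts_verifier hk hM (le_max_left _ _) (hC.trans (le_max_right _ _))).spec.2
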